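/- Let $b\in C^3(\mathbb R)$ be monotonically increasing, bounded, odd and Lipschitz, and let $w\in C^2(\mathbb R)\cap L^\infty(\mathbb R)$ be nonnegative and even. For a function $u$ on $\mathbb R^3$, with points written $(\theta,\sigma,r)$, set $$a[u](\theta,\sigma,r)=\int_{\mathbb R^3} w(r-r')\Big(b(\theta-\theta')+\tfrac12 b''(\theta-\theta')(\sigma^2+\sigma'^2)-b(r-r')\Big)\,u(\theta',\sigma',r')\,d\theta'\,d\sigma'\,dr'.$$ Let $f^0\in C^1(\mathbb R^3)$ have compact support (so that $f^0$ and $\partial_r f^0$ are bounded). Then for every $T\in(0,\infty)$ there is a unique classical solution $f\in C^1([0,T)\times\mathbb R^3)$ of $$\partial_t f+\partial_r\big(a[f]\,f\big)=0\ \text{ in }[0,T)\times\mathbb R^3,\qquad f(0,\cdot)=f^0 .$$ Here a classical solution is a function $f\in C^1([0,T)\times\mathbb R^3)$ such that $$\sup_{0\le s\le T'}\int_{\mathbb R^3}\big(1+|b''(\theta-\theta')|\big)\,(1+\sigma'^2)\,|f(s,\theta',\sigma',r')|\,d\theta'\,d\sigma'\,dr'<\infty\qquad\text{for all }\theta\in\mathbb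 R,\ T'<T$$ (so that the integral defining $a[f(t,\cdot)]$ converges absolutely), $a[f]f$ is differentiable in $r$, and the equation and the initial condition hold at every point, with the one-sided time derivative at $t=0$. -/

import Mathlib

open MeasureTheory Set

noncomputable section

namespace EloTeams

/-- The phase space `ℝ³`, with points `(θ, σ, r)` and its Lebesgue (product) measure. -/
abbrev Phase : Type := ℝ × ℝ × ℝ

/-- The assumption on the expected-outcome function `b`: it is `C³`, monotonically increasing,
bounded, odd and Lipschitz. -/
structure OutcomeFunction (b : ℝ → ℝ) : Prop where
  contDiff : ContDiff ℝ 3 b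
  monotone : Monotone b
  bounded : ∃ C : ℝ, ∀ z, |b z| ≤ C
  odd : Function.Odd b
  lipschitz : ∃ L : NNReal, LipschitzWith L b

/-- The assumption on the interaction rate function `w` (a function of the rating difference):
it is nonnegative, even, `C²` and bounded. -/
structure RateFunction (w : ℝ → ℝ) : Prop where
  contDiff : ContDiff ℝ 2 w
  nonneg : ∀ z, 0 ≤ w z
  even : Function.Even w
  bounded : ∃ C : ℝ, ∀ z, w z ≤ C

/-- The second derivative `b''`. -/
def secondDeriv (b : ℝ → ℝ) : ℝ → ℝ := iteratedDeriv 2 b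

/-- The variance correction `K(z, σ, σ') = ½ b''(z) (σ² + σ'²)`. -/
def varianceCorrection (b : ℝ → ℝ) (z σ σ' : ℝ) : ℝ :=
  1 / 2 * secondDeriv b z * (σ ^ 2 + σ' ^ 2)

/-- The drift
`a[u](θ, σ, r) = ∫ w(r-r') (b(θ-θ') + ½ b''(θ-θ') (σ²+σ'²) - b(r-r')) u(θ', σ', r') dθ' dσ' dr'`
generated by a density `u` on the phase space. -/
def drift (b w : ℝ → ℝ) (u : Phase → ℝ) (θ σ r : ℝ) : ℝ :=
  ∫ y : Phase, w (r - y.2.2) *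
    (b (θ - y.1) + varianceCorrection b (θ - y.1) σ y.2.1 - b (r - y.2.2)) * u y

/-- The integral defining the drift of `f(s)` converges absolutely, with bounds on the density
that are locally uniform in time on `[0, T)`:
for every `θ` and `T' < T`, the integrals of `(1 + |b''(θ-θ')|) (1 + σ'²) |f(s, θ', σ', r')|`
over the phase space are finite and bounded for `s ∈ [0, T']`. -/
def FiniteMoments (b : ℝ → ℝ) (T : ℝ) (f : ℝ → Phase → ℝ) : Prop :=
  ∀ θ : ℝ, ∀ T' < T, ∃ C : ℝ, ∀ s ∈ Icc 0 T',
    Integrable (fun y : Phase =>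
      (1 + |secondDeriv b (θ - y.1)|) * (1 + y.2.1 ^ 2) * |f s y|) ∧
    ∫ y : Phase, (1 + |secondDeriv b (θ - y.1)|) * (1 + y.2.1 ^ 2) * |f s y| ≤ C

/-- `f` is a classical solution on `[0, T) × ℝ³` of
`∂ₜ f + ∂ᵣ (a[f] f) = 0`, `f(0) = f₀`.
The time derivative at `t = 0` is the one-sided one. -/
structure IsClassicalSolution (b w : ℝ → ℝ) (f₀ : Phase → ℝ) (T : ℝ)
    (f : ℝ → Phase → ℝ) : Prop where
  /-- `f ∈ C¹([0, T) × ℝ³)`. -/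
  contDiffOn : ContDiffOn ℝ 1 (fun p : ℝ × Phase => f p.1 p.2) (Ico 0 T ×ˢ univ)
  /-- The drift is well defined. -/
  finiteMoments : FiniteMoments b T f
  /-- The flux `a[f] f` is differentiable in `r`. -/
  flux_differentiable : ∀ t ∈ Ico 0 T, ∀ θ σ r : ℝ,
    DifferentiableAt ℝ (fun ρ : ℝ => drift b w (f t) θ σ ρ * f t (θ, σ, ρ)) r
  /-- The equation holds at every point of `[0, T) × ℝ³`. -/
  equation : ∀ t ∈ Ico 0 T, ∀ θ σ r : ℝ,
    derivWithin (fun s : ℝ => f s (θ, σ, r)) (Ico 0 T) t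
      + deriv (fun ρ : ℝ => drift b w (f t) θ σ ρ * f t (θ, σ, ρ)) r = 0
  /-- The initial condition. -/
  initial : ∀ x : Phase, f 0 x = f₀ x

end EloTeams

end

open MeasureTheory Set

set_option linter.unusedSectionVars false

noncomputable section

namespace EloTeams

open Filter Topology Function

section

/-! ### Differentiation of integrals depending on a parameter. -/

section ParametricIntegrals

variable {Q E : Type*} [NormedAddCommGroup Q] [NormedSpace ℝ Q] [NormedAddCommGroup E]
  [NormedSpace ℝ E]

/-- A function whose increments are `f y - f x = L y (y - x)` with `L` continuous at `x` is
differentiable at `x` with derivative `L x`. -/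
theorem hasFDerivAt_of_slope {f : Q → E} {L : Q → Q →L[ℝ] E} {x : Q} (hL : ContinuousAt L x)
    (hf : ∀ y, f y - f x = L y (y - x)) : HasFDerivAt f (L x) x := by
  rw [hasFDerivAt_iff_isLittleO, Asymptotics.isLittleO_iff]
  intro c hc
  filter_upwards [Metric.continuousAt_iff'.1 hL c hc] with y hy
  rw [hf y, ← sub_apply]
  refine (ContinuousLinearMap.le_opNorm _ _).trans ?_
  gcongr
  rw [← dist_eq_norm]
  exact hy.le

variable {Y : Type*} [TopologicalSpace Y] [TopologicalSpace.MetrizableSpace Y]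
  [SecondCountableTopology Y] [MeasurableSpace Y] [OpensMeasurableSpace Y]
  {μ : Measure Y} [IsLocallyFiniteMeasure μ]

/-- The maximum of `F'` over a compact neighbourhood times `s` is a constant dominating function. -/
theorem hasFDerivAt_setIntegral_of_isCompact [LocallyCompactSpace Q] {U : Set Q} (hU : IsOpen U)
    {F : Q → Y → E} {F' : Q → Y → Q →L[ℝ] E} (hF : ContinuousOn (uncurry F) (U ×ˢ univ))
    (hF' : ContinuousOn (uncurry F') (U ×ˢ univ))
    (hd : ∀ q ∈ U, ∀ y, HasFDerivAt (fun q => F q y) (F' q y) q) {s : Set Y} (hs : IsCompact s)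
    {q : Q} (hq : q ∈ U) :
    HasFDerivAt (fun q => ∫ y in s, F q y ∂μ) (∫ y in s, F' q y ∂μ) q := by
  obtain ⟨N, hN, hNU, hNc⟩ := local_compact_nhds (hU.mem_nhds hq)
  obtain ⟨C, hC⟩ := (hNc.prod hs).exists_bound_of_continuousOn
    (hF'.mono (prod_mono hNU (subset_univ s)))
  have cF : ∀ q ∈ U, Continuous (F q) := fun q hq =>
    hF.comp_continuous (f := fun y => (q, y)) (by fun_prop) (fun y => ⟨hq, mem_univ _⟩)
  have cF' : Continuous (F' q) :=
    hF'.comp_continuous (f := fun y => (q, y)) (by fun_prop) (fun y => ⟨hq, mem_univ _⟩)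
  have hfin : μ s ≠ ⊤ := hs.measure_lt_top.ne
  refine hasFDerivAt_integral_of_dominated_of_fderiv_le (bound := fun _ => C) hN ?_ ?_ ?_ ?_ ?_ ?_
  · filter_upwards [hU.mem_nhds hq] with x hx using (cF x hx).aestronglyMeasurable
  · exact (cF q hq).continuousOn.integrableOn_compact' hs hs.measurableSet
  · exact cF'.aestronglyMeasurable
  · filter_upwards [ae_restrict_mem hs.measurableSet] with y hy x hx using hC (x, y) ⟨hx, hy⟩
  · exact integrableOn_const hfin
  · exact .of_forall fun y x hx => hd x (hNU hx) y

theorem intervalIntegral_eq_setIntegral_Icc_sub (f : ℝ → E) (a b : ℝ) :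
    ∫ s in a..b, f s = (∫ s in Icc a b, f s) - ∫ s in Icc b a, f s := by
  rw [intervalIntegral, integral_Icc_eq_integral_Ioc, integral_Icc_eq_integral_Ioc]

theorem hasFDerivAt_intervalIntegral [LocallyCompactSpace Q] {U : Set Q} (hU : IsOpen U)
    {F : Q → ℝ → E} {F' : Q → ℝ → Q →L[ℝ] E} (hF : ContinuousOn (uncurry F) (U ×ˢ univ))
    (hF' : ContinuousOn (uncurry F') (U ×ˢ univ))
    (hd : ∀ q ∈ U, ∀ s, HasFDerivAt (fun q => F q s) (F' q s) q) (a b : ℝ)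
    {q : Q} (hq : q ∈ U) :
    HasFDerivAt (fun q => ∫ s in a..b, F q s) (∫ s in a..b, F' q s) q := by
  simp only [intervalIntegral_eq_setIntegral_Icc_sub]
  exact (hasFDerivAt_setIntegral_of_isCompact hU hF hF' hd isCompact_Icc hq).sub
    (hasFDerivAt_setIntegral_of_isCompact hU hF hF' hd isCompact_Icc hq)

theorem continuousOn_primitive [LocallyCompactSpace Q] {U : Set Q} (hU : IsOpen U)
    {F : Q → ℝ → E} (hF : ContinuousOn (uncurry F) (U ×ˢ univ)) :
    ContinuousOn (fun z : Q × ℝ => ∫ s in (0 : ℝ)..z.2, F z.1 s) (U ×ˢ univ) := by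
  rw [continuousOn_iff_continuous_domRestrict]
  have h : Continuous (uncurry fun (q : U) s => F q s) := by
    have : Continuous fun z : U × ℝ => uncurry F ((z.1 : Q), z.2) :=
      hF.comp_continuous (by fun_prop) (fun z => ⟨z.1.2, mem_univ _⟩)
    exact this
  have hU' : LocallyCompactSpace U := hU.isOpenEmbedding_subtypeVal.locallyCompactSpace
  have h2 := intervalIntegral.continuous_parametric_primitive_of_continuous (μ := volume)
    (a₀ := 0) h
  exact h2.comp (f := fun z : (U ×ˢ (univ : Set ℝ) : Set (Q × ℝ)) =>
    ((⟨z.1.1, z.2.1⟩ : U), z.1.2)) (by fun_prop)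

/-- The primitive `(q, t) ↦ ∫ s in 0..t, F q s` of a function that is continuously differentiable
in the parameter is strictly differentiable. -/
theorem hasStrictFDerivAt_primitive [LocallyCompactSpace Q] [CompleteSpace E] {U : Set Q}
    (hU : IsOpen U)
    {F : Q → ℝ → E} {F' : Q → ℝ → Q →L[ℝ] E} (hF : ContinuousOn (uncurry F) (U ×ˢ univ))
    (hF' : ContinuousOn (uncurry F') (U ×ˢ univ))
    (hd : ∀ q ∈ U, ∀ s, HasFDerivAt (fun q => F q s) (F' q s) q) {q : Q} (hq : q ∈ U) (t : ℝ) :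
    HasStrictFDerivAt (fun z : Q × ℝ => ∫ s in (0 : ℝ)..z.2, F z.1 s)
      ((∫ s in (0 : ℝ)..t, F' q s).coprod
        (ContinuousLinearMap.toSpanSingleton ℝ (F q t))) (q, t) := by
  have hev : ∀ᶠ v : Q × ℝ in 𝓝 (q, t), v ∈ U ×ˢ (univ : Set ℝ) :=
    (hU.prod isOpen_univ).mem_nhds ⟨hq, mem_univ _⟩
  have cF : ∀ q ∈ U, Continuous (F q) := fun q hq =>
    hF.comp_continuous (f := fun y => (q, y)) (by fun_prop) (fun y => ⟨hq, mem_univ _⟩)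
  refine hasStrictFDerivAt_uncurry_coprod (u := (q, t))
    (f := fun q t => ∫ s in (0 : ℝ)..t, F q s)
    (f₁ := fun q t => ∫ s in (0 : ℝ)..t, F' q s)
    (f₂ := fun q t => ContinuousLinearMap.toSpanSingleton ℝ (F q t)) ?_ ?_ ?_ ?_
  · filter_upwards [hev] with v hv
    exact hasFDerivAt_intervalIntegral hU hF hF' hd 0 v.2 hv.1
  · filter_upwards [hev] with v hv
    exact ((cF v.1 hv.1).integral_hasStrictDerivAt 0 v.2).hasDerivAt.hasFDerivAt
  · exact (continuousOn_primitive hU hF').continuousAt hev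
  · have := (ContinuousLinearMap.toSpanSingletonCLE (𝕜 := ℝ) (E := E)).continuous.comp_continuousOn hF
    exact this.continuousAt hev

theorem contDiff_primitive [LocallyCompactSpace Q] [CompleteSpace E]
    {F : Q → ℝ → E} {F' : Q → ℝ → Q →L[ℝ] E} (hF : Continuous (uncurry F))
    (hF' : Continuous (uncurry F')) (hd : ∀ q s, HasFDerivAt (fun q => F q s) (F' q s) q) :
    ContDiff ℝ 1 (fun z : Q × ℝ => ∫ s in (0 : ℝ)..z.2, F z.1 s) := by
  rw [contDiff_one_iff_hasFDerivAt]
  refine ⟨fun z => (∫ s in (0 : ℝ)..z.2, F' z.1 s).coprod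
    (ContinuousLinearMap.toSpanSingleton ℝ (F z.1 z.2)), ?_, fun z => ?_⟩
  · have h1 : Continuous fun z : Q × ℝ => ∫ s in (0 : ℝ)..z.2, F' z.1 s :=
      intervalIntegral.continuous_parametric_primitive_of_continuous hF'
    have h2 : Continuous fun z : Q × ℝ => ContinuousLinearMap.toSpanSingleton ℝ (F z.1 z.2) :=
      (ContinuousLinearMap.toSpanSingletonCLE (𝕜 := ℝ) (E := E)).continuous.comp hF
    exact h1.continuousLinearMapCoprod h2
  · exact (hasStrictFDerivAt_primitive isOpen_univ hF.continuousOn hF'.continuousOn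
      (fun q _ s => hd q s) (mem_univ z.1) z.2).hasFDerivAt

end ParametricIntegrals

end

/-! ### The interaction kernel: regularity and bounds. -/

section

/-- The interaction kernel, so that `drift b w u θ σ r = ∫ y, kernel b w (θ, σ, r) y * u y`. -/
def kernel (b w : ℝ → ℝ) (q y : Phase) : ℝ :=
  w (q.2.2 - y.2.2) *
    (b (q.1 - y.1) + varianceCorrection b (q.1 - y.1) q.2.1 y.2.1 - b (q.2.2 - y.2.2))

/-- The derivative of the interaction kernel in the rating `r`. -/
def kernelDeriv (b w : ℝ → ℝ) (q y : Phase) : ℝ :=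
  deriv w (q.2.2 - y.2.2) *
    (b (q.1 - y.1) + varianceCorrection b (q.1 - y.1) q.2.1 y.2.1 - b (q.2.2 - y.2.2)) -
  w (q.2.2 - y.2.2) * deriv b (q.2.2 - y.2.2)

variable {b w : ℝ → ℝ}

theorem drift_eq (u : Phase → ℝ) (θ σ r : ℝ) :
    drift b w u θ σ r = ∫ y, kernel b w (θ, σ, r) y * u y := rfl

theorem OutcomeFunction.contDiff_secondDeriv (hb : OutcomeFunction b) :
    ContDiff ℝ 1 (secondDeriv b) := by
  have := hb.contDiff.iterate_deriv' 1 2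
  rwa [← iteratedDeriv_eq_iterate] at this

theorem OutcomeFunction.contDiff_deriv (hb : OutcomeFunction b) : ContDiff ℝ 1 (deriv b) := by
  have := (hb.contDiff.of_le (by norm_num : (2 : WithTop ℕ∞) ≤ 3)).iterate_deriv' 1 1
  exact this

theorem RateFunction.contDiff_deriv (hw : RateFunction w) : ContDiff ℝ 1 (deriv w) := by
  exact hw.contDiff.iterate_deriv' 1 1

theorem contDiff_kernel (hb : OutcomeFunction b) (hw : RateFunction w) :
    ContDiff ℝ 1 (uncurry (kernel b w)) := by
  have h1 : ContDiff ℝ 1 b := hb.contDiff.of_le (by norm_num)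
  have h2 : ContDiff ℝ 1 w := hw.contDiff.of_le (by norm_num)
  have h3 := hb.contDiff_secondDeriv
  unfold kernel varianceCorrection uncurry
  fun_prop

/-- The rating derivative never falls on `b''`, whose argument is the strength difference; hence it
is as regular as the kernel, although `b''` is only `C¹`. -/
theorem contDiff_kernelDeriv (hb : OutcomeFunction b) (hw : RateFunction w) :
    ContDiff ℝ 1 (uncurry (kernelDeriv b w)) := by
  have h1 : ContDiff ℝ 1 b := hb.contDiff.of_le (by norm_num)
  have h2 : ContDiff ℝ 1 w := hw.contDiff.of_le (by norm_num)
  have h3 := hb.contDiff_secondDeriv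
  have h4 := hb.contDiff_deriv
  have h5 := hw.contDiff_deriv
  unfold kernelDeriv varianceCorrection uncurry
  fun_prop

theorem hasDerivAt_kernel (hb : OutcomeFunction b) (hw : RateFunction w) (θ σ r : ℝ) (y : Phase) :
    HasDerivAt (fun ρ => kernel b w (θ, σ, ρ) y) (kernelDeriv b w (θ, σ, r) y) r := by
  have h1 : HasDerivAt b (deriv b (r - y.2.2)) (r - y.2.2) :=
    (hb.contDiff.differentiable (by norm_num)).differentiableAt.hasDerivAt
  have h2 : HasDerivAt w (deriv w (r - y.2.2)) (r - y.2.2) :=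
    (hw.contDiff.differentiable (by norm_num)).differentiableAt.hasDerivAt
  have h3 : HasDerivAt (fun ρ => b (ρ - y.2.2)) (deriv b (r - y.2.2)) r := h1.comp_sub_const r _
  have h4 : HasDerivAt (fun ρ => w (ρ - y.2.2)) (deriv w (r - y.2.2)) r := h2.comp_sub_const r _
  unfold kernel kernelDeriv
  convert! h4.mul (h3.const_sub (b (θ - y.1) + varianceCorrection b (θ - y.1) σ y.2.1)) using 1
  ring

theorem hasDerivAt_kernel_right (hb : OutcomeFunction b) (hw : RateFunction w) (q : Phase)
    (θ σ r : ℝ) :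
    HasDerivAt (fun ρ => kernel b w q (θ, σ, ρ)) (-kernelDeriv b w q (θ, σ, r)) r := by
  have h1 : HasDerivAt b (deriv b (q.2.2 - r)) (q.2.2 - r) :=
    (hb.contDiff.differentiable (by norm_num)).differentiableAt.hasDerivAt
  have h2 : HasDerivAt w (deriv w (q.2.2 - r)) (q.2.2 - r) :=
    (hw.contDiff.differentiable (by norm_num)).differentiableAt.hasDerivAt
  have h3 : HasDerivAt (fun ρ => b (q.2.2 - ρ)) (-deriv b (q.2.2 - r)) r := h1.comp_const_sub _ r
  have h4 : HasDerivAt (fun ρ => w (q.2.2 - ρ)) (-deriv w (q.2.2 - r)) r := h2.comp_const_sub _ r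
  unfold kernel kernelDeriv
  convert! h4.mul (h3.const_sub (b (q.1 - θ) + varianceCorrection b (q.1 - θ) q.2.1 σ)) using 1
  ring

/-- The factor depending on `y` is exactly the weight of `FiniteMoments`, so the moment bound
dominates the drift integrand uniformly in the rating. -/
theorem exists_abs_kernel_le (hb : OutcomeFunction b) (hw : RateFunction w) :
    ∃ A, 0 ≤ A ∧ ∀ q y : Phase, |kernel b w q y| ≤
      A * (1 + q.2.1 ^ 2) * ((1 + |secondDeriv b (q.1 - y.1)|) * (1 + y.2.1 ^ 2)) := by
  obtain ⟨W, hW⟩ := hw.bounded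
  obtain ⟨B, hB⟩ := hb.bounded
  have hW0 : 0 ≤ W := (hw.nonneg 0).trans (hW 0)
  have hB0 : 0 ≤ B := (abs_nonneg _).trans (hB 0)
  refine ⟨W * (2 * B + 1), by positivity, fun q y => ?_⟩
  unfold kernel varianceCorrection
  rw [abs_mul, mul_assoc W, mul_assoc W]
  refine mul_le_mul ((abs_of_nonneg (hw.nonneg _)).trans_le (hW _)) ?_ (abs_nonneg _) hW0
  set s := |secondDeriv b (q.1 - y.1)| with hs
  have hs0 : 0 ≤ s := abs_nonneg _
  have h1 : |1 / 2 * secondDeriv b (q.1 - y.1) * (q.2.1 ^ 2 + y.2.1 ^ 2)| =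
      1 / 2 * s * (q.2.1 ^ 2 + y.2.1 ^ 2) := by
    rw [abs_mul, abs_mul, abs_of_pos (by norm_num : (0 : ℝ) < 1 / 2),
      abs_of_nonneg (by positivity : 0 ≤ q.2.1 ^ 2 + y.2.1 ^ 2)]
  have h2 := abs_sub (b (q.1 - y.1) + 1 / 2 * secondDeriv b (q.1 - y.1) *
    (q.2.1 ^ 2 + y.2.1 ^ 2)) (b (q.2.2 - y.2.2))
  have h3 := abs_add_le (b (q.1 - y.1)) (1 / 2 * secondDeriv b (q.1 - y.1) *
    (q.2.1 ^ 2 + y.2.1 ^ 2))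
  have h4 := hB (q.1 - y.1)
  have h5 := hB (q.2.2 - y.2.2)
  set u := q.2.1 ^ 2
  set v := y.2.1 ^ 2
  have hu : 0 ≤ u := sq_nonneg _
  have hv : 0 ≤ v := sq_nonneg _
  have h6 : 1 ≤ (1 + u) * ((1 + s) * (1 + v)) := by
    have : 0 ≤ u * ((1 + s) * (1 + v)) := by positivity
    have : 0 ≤ s * v := by positivity
    nlinarith
  have h7 : 1 / 2 * s * (u + v) ≤ (1 + u) * ((1 + s) * (1 + v)) := by
    have e : (1 + u) * ((1 + s) * (1 + v)) - 1 / 2 * s * (u + v) =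
      1 / 2 * s * (u + v) + 1 + s + u + v + u * v + s * u * v := by ring
    have : 0 ≤ 1 / 2 * s * (u + v) + 1 + s + u + v + u * v + s * u * v := by positivity
    linarith
  nlinarith [mul_le_mul_of_nonneg_left h6 (by positivity : 0 ≤ 2 * B)]

/-- The kernel is bounded when the strengths and deviations are. -/
theorem exists_abs_kernel_le_of_norm_le (hb : OutcomeFunction b) (hw : RateFunction w) (R : ℝ) :
    ∃ B, 0 ≤ B ∧ ∀ q y : Phase, |q.1| ≤ R → |q.2.1| ≤ R → |y.1| ≤ R → |y.2.1| ≤ R →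
      |kernel b w q y| ≤ B := by
  obtain ⟨A, hA, h⟩ := exists_abs_kernel_le hb hw
  obtain ⟨S, hS⟩ := (isCompact_Icc (a := -(2 * R)) (b := 2 * R)).exists_bound_of_continuousOn
    hb.contDiff_secondDeriv.continuous.continuousOn
  refine ⟨A * (1 + R ^ 2) * ((1 + |S|) * (1 + R ^ 2)), by positivity, fun q y h1 h2 h3 h4 => ?_⟩
  refine (h q y).trans ?_
  have h5 : |secondDeriv b (q.1 - y.1)| ≤ |S| := by
    refine (hS _ ?_).trans (le_abs_self S)
    rw [abs_le] at h1 h3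
    constructor <;> linarith
  have h6 : q.2.1 ^ 2 ≤ R ^ 2 := sq_le_sq' (abs_le.1 h2).1 (abs_le.1 h2).2
  have h7 : y.2.1 ^ 2 ≤ R ^ 2 := sq_le_sq' (abs_le.1 h4).1 (abs_le.1 h4).2
  gcongr

end

/-! ### Finite speed of propagation for scalar conservation laws. -/

section

/-- First-order condition at a maximum when only one direction is admissible; below, `δ` measures
time backwards from the maximum, which may sit at the final time. -/
theorem HasDerivAt.nonpos_of_forall_le {ψ : ℝ → ℝ} {d η : ℝ} (h : HasDerivAt ψ d 0) (hη : 0 < η)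
    (hle : ∀ δ ∈ Ioo 0 η, ψ δ ≤ ψ 0) : d ≤ 0 := by
  have h1 : Tendsto (slope ψ 0) (𝓝[>] 0) (𝓝 d) :=
    (hasDerivWithinAt_iff_tendsto_slope' (by simp)).1 (h.hasDerivWithinAt (s := Ioi 0))
  refine le_of_tendsto h1 ?_
  filter_upwards [Ioo_mem_nhdsGT hη] with δ hδ
  rw [slope_def_field]
  exact div_nonpos_of_nonpos_of_nonneg (by linarith [hle δ hδ]) (by linarith [hδ.1])

/-- The time derivative of a function that is `C¹` on a half-open time interval. -/
theorem hasDerivAt_time {Q : Type*} [NormedAddCommGroup Q] [NormedSpace ℝ Q] {T : ℝ}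
    {u : ℝ → Q → ℝ} (hu : ContDiffOn ℝ 1 (uncurry u) (Ico 0 T ×ˢ univ)) {t : ℝ}
    (ht : t ∈ Ioo 0 T) (r : Q) :
    HasDerivAt (fun s => u s r) (fderiv ℝ (uncurry u) (t, r) (1, 0)) t ∧
      derivWithin (fun s => u s r) (Ico 0 T) t = fderiv ℝ (uncurry u) (t, r) (1, 0) := by
  have hn : Ico 0 T ×ˢ (univ : Set Q) ∈ 𝓝 (t, r) :=
    prod_mem_nhds (Ico_mem_nhds ht.1 ht.2) univ_mem
  have h1 : HasFDerivAt (uncurry u) (fderiv ℝ (uncurry u) (t, r)) (t, r) :=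
    ((hu.contDiffAt hn).differentiableAt (by norm_num)).hasFDerivAt
  have h2 : HasDerivAt (fun s => u s r) (fderiv ℝ (uncurry u) (t, r) (1, 0)) t := by
    have h3 : HasDerivAt (fun s : ℝ => (s, r)) ((1 : ℝ), (0 : Q)) t :=
      (hasDerivAt_id t).prodMk (hasDerivAt_const t r)
    exact h1.comp_hasDerivAt (f := fun s : ℝ => (s, r)) t h3
  exact ⟨h2, h2.hasDerivWithinAt.derivWithin
    (uniqueDiffOn_Ico 0 T t (Ioo_subset_Ico_self ht))⟩

theorem continuousOn_fderiv_time {Q : Type*} [NormedAddCommGroup Q] [NormedSpace ℝ Q] {T : ℝ}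
    {u : ℝ → Q → ℝ} (hu : ContDiffOn ℝ 1 (uncurry u) (Ico 0 T ×ˢ univ)) :
    ContinuousOn (fun z => fderiv ℝ (uncurry u) z (1, 0)) (Ioo 0 T ×ˢ (univ : Set Q)) := by
  have h := (hu.mono (prod_mono_left Ioo_subset_Ico_self)).continuousOn_fderiv_of_isOpen
    (isOpen_Ioo.prod isOpen_univ) le_rfl
  exact h.clm_apply continuousOn_const

section OneDim

variable {T : ℝ} {u F : ℝ → ℝ → ℝ}

/-- The partial mass changes in time by the flux difference. The flux is only assumed
differentiable, but its derivative is `-∂ₜu`, which is continuous, so the fundamental theorem of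
calculus applies. -/
theorem hasFDerivAt_mass (hu : ContDiffOn ℝ 1 (uncurry u) (Ico 0 T ×ˢ univ))
    (hF : ∀ t ∈ Ico 0 T, Differentiable ℝ (F t))
    (heq : ∀ t ∈ Ico 0 T, ∀ r, derivWithin (fun s => u s r) (Ico 0 T) t + deriv (F t) r = 0)
    {t : ℝ} (ht : t ∈ Ioo 0 T) (r : ℝ) :
    HasFDerivAt (fun z : ℝ × ℝ => ∫ s in (0 : ℝ)..z.2, u z.1 s)
      ((ContinuousLinearMap.toSpanSingleton ℝ (-(F t r - F t 0))).coprod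
        (ContinuousLinearMap.toSpanSingleton ℝ (u t r))) (t, r) := by
  have hc : ContinuousOn (uncurry u) (Ioo 0 T ×ˢ univ) :=
    hu.continuousOn.mono (prod_mono_left Ioo_subset_Ico_self)
  have hv := continuousOn_fderiv_time hu
  have hv' : ContinuousOn (uncurry fun q s => ContinuousLinearMap.toSpanSingleton ℝ
      (fderiv ℝ (uncurry u) (q, s) (1, 0))) (Ioo 0 T ×ˢ univ) :=
    (ContinuousLinearMap.toSpanSingletonCLE (𝕜 := ℝ) (E := ℝ)).continuous.comp_continuousOn hv
  have h := (hasStrictFDerivAt_primitive isOpen_Ioo hc hv'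
    (fun q hq s => (hasDerivAt_time hu hq s).1.hasFDerivAt) ht r).hasFDerivAt
  convert! h using 2
  have hvc : Continuous fun s => fderiv ℝ (uncurry u) (t, s) (1, 0) :=
    hv.comp_continuous (f := fun s => (t, s)) (by fun_prop) (fun s => ⟨ht, mem_univ _⟩)
  have hvc' : Continuous fun s => ContinuousLinearMap.toSpanSingleton ℝ
      (fderiv ℝ (uncurry u) (t, s) (1, 0)) :=
    (ContinuousLinearMap.toSpanSingletonCLE (𝕜 := ℝ) (E := ℝ)).continuous.comp hvc
  have hi : ∫ s in (0 : ℝ)..r, fderiv ℝ (uncurry u) (t, s) (1, 0) = -F t r - -F t 0 := by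
    refine intervalIntegral.integral_eq_sub_of_hasDerivAt (f := fun r => -F t r) (fun s _ => ?_)
      (hvc.intervalIntegrable _ _)
    have h1 := heq t (Ioo_subset_Ico_self ht) s
    rw [(hasDerivAt_time hu ht s).2] at h1
    have h2 := (hF t (Ioo_subset_Ico_self ht) s).hasDerivAt.neg
    convert! h2 using 1
    linarith
  ext
  rw [ContinuousLinearMap.intervalIntegral_apply (hvc'.intervalIntegrable _ _)]
  simp only [ContinuousLinearMap.toSpanSingleton_apply, smul_eq_mul, one_mul]
  rw [hi]
  ring

/-- Supplies continuity up to `t = 0`, needed for maxima over compact sets in space-time;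
differentiability is available only for positive times. -/
theorem continuousOn_mass (hu : ContinuousOn (uncurry u) (Ico 0 T ×ˢ univ)) {T' : ℝ}
    (hT' : T' < T) :
    ContinuousOn (fun z : ℝ × ℝ => ∫ s in (0 : ℝ)..z.2, u z.1 s) (Icc 0 T' ×ˢ univ) := by
  rcases lt_or_ge T' 0 with h | h
  · simp [Icc_eq_empty_of_lt h]
  have h1 : Continuous (uncurry fun t s => u (projIcc 0 T' h t) s) := by
    have : Continuous fun z : ℝ × ℝ => uncurry u ((projIcc 0 T' h z.1 : ℝ), z.2) :=
      hu.comp_continuous (by fun_prop) fun z =>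
        ⟨⟨(projIcc 0 T' h z.1).2.1, (projIcc 0 T' h z.1).2.2.trans_lt hT'⟩, mem_univ _⟩
    exact this
  have h2 := intervalIntegral.continuous_parametric_primitive_of_continuous (μ := volume)
    (a₀ := 0) h1
  refine h2.continuousOn.congr fun z hz => ?_
  simp only [projIcc_of_mem h hz.1]

/-- A solution of `∂ₜ u + ∂ᵣ F = 0` with `|F| ≤ A |u|` propagates with speed at most `A`. -/
theorem eq_zero_of_flux_le (hu : ContDiffOn ℝ 1 (uncurry u) (Ico 0 T ×ˢ univ))
    (hF : ∀ t ∈ Ico 0 T, Differentiable ℝ (F t))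
    (heq : ∀ t ∈ Ico 0 T, ∀ r, derivWithin (fun s => u s r) (Ico 0 T) t + deriv (F t) r = 0)
    {T' A ℓ R : ℝ} (hT' : T' < T) (hA : 0 ≤ A) (hbd : ∀ t ∈ Icc 0 T', ∀ r, |F t r| ≤ A * |u t r|)
    (h0 : ∀ r ∈ Icc ℓ R, u 0 r = 0) {t r : ℝ} (ht : t ∈ Icc 0 T') (hl : ℓ + A * t < r)
    (hr : r < R - A * t) : u t r = 0 := by
  set P : ℝ → ℝ → ℝ := fun t r => ∫ s in (0 : ℝ)..r, u t s with hP
  -- Two points of the shrinking interval are carried at once: in the difference of partial masses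
  -- the unknown flux at `0` cancels, and exchanging the points reverses the inequality.
  set cone : Set (ℝ × ℝ × ℝ) := {z | z.1 ∈ Icc 0 T' ∧ (ℓ + A * z.1 ≤ z.2.1 ∧ z.2.1 ≤ R - A * z.1) ∧
    (ℓ + A * z.1 ≤ z.2.2 ∧ z.2.2 ≤ R - A * z.1)} with hcone
  have hcomp : IsCompact cone := by
    refine ((isCompact_Icc (a := 0) (b := T')).prod ((isCompact_Icc (a := ℓ) (b := R)).prod
      (isCompact_Icc (a := ℓ) (b := R)))).of_isClosed_subset ?_ ?_
    · have e : cone = {z : ℝ × ℝ × ℝ | z.1 ∈ Icc 0 T'} ∩ ({z | ℓ + A * z.1 ≤ z.2.1} ∩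
        {z | z.2.1 ≤ R - A * z.1} ∩ ({z | ℓ + A * z.1 ≤ z.2.2} ∩ {z | z.2.2 ≤ R - A * z.1})) := rfl
      rw [e]
      refine (isClosed_Icc.preimage continuous_fst).inter
        (((isClosed_le ?_ ?_).inter (isClosed_le ?_ ?_)).inter
          ((isClosed_le ?_ ?_).inter (isClosed_le ?_ ?_))) <;> fun_prop
    · rintro ⟨t, r₁, r₂⟩ ⟨h1, ⟨h2, h3⟩, h4, h5⟩
      have : 0 ≤ A * t := mul_nonneg hA h1.1
      exact ⟨h1, ⟨by linarith, by linarith⟩, by linarith, by linarith⟩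
  have hcu : ∀ t ∈ Ico 0 T, Continuous (u t) := fun t ht =>
    hu.continuousOn.comp_continuous (f := fun r => (t, r)) (by fun_prop)
      (fun _ => ⟨ht, mem_univ _⟩)
  have hPsub : ∀ t ∈ Ico 0 T, ∀ r₁ r₂, P t r₂ - P t r₁ = ∫ s in r₁..r₂, u t s :=
    fun t ht r₁ r₂ => intervalIntegral.integral_interval_sub_left
      ((hcu t ht).intervalIntegrable _ _) ((hcu t ht).intervalIntegrable _ _)
  -- The term `ε t` makes the inequality at a maximum strict; `ε` tends to `0` afterwards.
  have key : ∀ ε > 0, ∀ z ∈ cone, P z.1 z.2.2 - P z.1 z.2.1 - ε * z.1 ≤ 0 := by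
    intro ε hε z hz
    have hPc := continuousOn_mass hu.continuousOn hT'
    have hφ : ContinuousOn (fun z : ℝ × ℝ × ℝ => P z.1 z.2.2 - P z.1 z.2.1 - ε * z.1) cone := by
      have c1 : ContinuousOn (fun z : ℝ × ℝ × ℝ => P z.1 z.2.2) cone :=
        hPc.comp (f := fun z : ℝ × ℝ × ℝ => (z.1, z.2.2)) (by fun_prop)
          fun z hz => ⟨hz.1, mem_univ _⟩
      have c2 : ContinuousOn (fun z : ℝ × ℝ × ℝ => P z.1 z.2.1) cone :=
        hPc.comp (f := fun z : ℝ × ℝ × ℝ => (z.1, z.2.1)) (by fun_prop)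
          fun z hz => ⟨hz.1, mem_univ _⟩
      exact (c1.sub c2).sub (by fun_prop)
    obtain ⟨⟨t₀, ρ₁, ρ₂⟩, hz₀, hmax⟩ := hcomp.exists_isMaxOn ⟨z, hz⟩ hφ
    refine (hmax hz).trans ?_
    obtain ⟨h1, ⟨h2, h3⟩, h4, h5⟩ := hz₀
    simp only at h1 h2 h3 h4 h5 ⊢
    rcases h1.1.eq_or_lt with rfl | ht₀
    · rw [hPsub 0 ⟨le_rfl, h1.2.trans_lt hT'⟩, intervalIntegral.integral_congr (g := fun _ => 0)]
      · simp
      · intro s hs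
        refine h0 s ((uIcc_subset_Icc ⟨?_, ?_⟩ ⟨?_, ?_⟩) hs) <;> linarith
    exfalso
    have ht₀' : t₀ ∈ Ioo 0 T := ⟨ht₀, h1.2.trans_lt hT'⟩
    -- Backwards in time the cone widens at speed `A`, so both endpoints may move at that speed in
    -- either direction. With these signs the motion contributes `A |u|` at each endpoint, which
    -- absorbs the fluxes and leaves a derivative of at least `ε`.
    set e₁ : ℝ := -(SignType.sign (u t₀ ρ₁) : ℝ) with he₁
    set e₂ : ℝ := (SignType.sign (u t₀ ρ₂) : ℝ) with he₂
    have hsgn : ∀ x : ℝ, |(SignType.sign x : ℝ)| ≤ 1 := by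
      intro x
      rcases lt_trichotomy x 0 with h | h | h <;> simp [h]
    have b₁ : |e₁| ≤ 1 := by rw [he₁, abs_neg]; exact hsgn _
    have b₂ : |e₂| ≤ 1 := hsgn _
    have hd : ∀ (ρ e : ℝ), HasDerivAt (fun δ => P (t₀ - δ) (ρ + A * δ * e))
        ((F t₀ ρ - F t₀ 0) + A * e * u t₀ ρ) 0 := by
      intro ρ e
      have g1 := hasFDerivAt_mass hu hF heq ht₀' ρ
      have g2 : HasDerivAt (fun δ : ℝ => (t₀ - δ, ρ + A * δ * e)) ((-1 : ℝ), A * e) 0 := by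
        refine ((hasDerivAt_id (0 : ℝ)).const_sub t₀).prodMk ?_
        have := (((hasDerivAt_id (0 : ℝ)).const_mul A).mul_const e).const_add ρ
        simpa using this
      have g3 := HasFDerivAt.comp_hasDerivAt (f := fun δ : ℝ => (t₀ - δ, ρ + A * δ * e)) 0
        (by simpa using g1) g2
      convert! g3 using 1
      simp
    have hψ := ((hd ρ₂ e₂).sub (hd ρ₁ e₁)).sub
      (((hasDerivAt_id (0 : ℝ)).const_sub t₀).const_mul ε)
    have hle := HasDerivAt.nonpos_of_forall_le hψ ht₀ (fun δ hδ => by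
      have hm : ((t₀ - δ, ρ₁ + A * δ * e₁, ρ₂ + A * δ * e₂) : ℝ × ℝ × ℝ) ∈ cone := by
        have i1 : |A * δ * e₁| ≤ A * δ := by
          rw [abs_mul, abs_of_nonneg (mul_nonneg hA hδ.1.le)]
          exact mul_le_of_le_one_right (mul_nonneg hA hδ.1.le) b₁
        have i2 : |A * δ * e₂| ≤ A * δ := by
          rw [abs_mul, abs_of_nonneg (mul_nonneg hA hδ.1.le)]
          exact mul_le_of_le_one_right (mul_nonneg hA hδ.1.le) b₂
        rw [abs_le] at i1 i2
        refine ⟨⟨by linarith [hδ.2], by linarith [hδ.1, h1.2]⟩, ⟨?_, ?_⟩, ?_, ?_⟩ <;>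
          simp only [mul_sub] <;> linarith [i1.1, i1.2, i2.1, i2.2]
      have := hmax hm
      simpa using this)
    have a1 : e₂ * u t₀ ρ₂ = |u t₀ ρ₂| := sign_mul_self _
    have a2 : e₁ * u t₀ ρ₁ = -|u t₀ ρ₁| := by rw [he₁, neg_mul, sign_mul_self]
    have a3 := hbd t₀ h1 ρ₁
    have a4 := hbd t₀ h1 ρ₂
    rw [abs_le] at a3 a4
    rw [mul_assoc, a1, mul_assoc, a2] at hle
    linarith [a3.1, a3.2, a4.1, a4.2]
  have key2 : ∀ z ∈ cone, P z.1 z.2.2 - P z.1 z.2.1 ≤ 0 := by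
    intro z hz
    have h1 : Tendsto (fun ε : ℝ => P z.1 z.2.2 - P z.1 z.2.1 - ε * z.1) (𝓝[>] 0)
        (𝓝 (P z.1 z.2.2 - P z.1 z.2.1 - 0 * z.1)) :=
      (Continuous.tendsto (by fun_prop) 0).mono_left nhdsWithin_le_nhds
    rw [zero_mul, sub_zero] at h1
    refine le_of_tendsto h1 ?_
    filter_upwards [self_mem_nhdsWithin] with ε hε using key ε hε z hz
  have ht' : t ∈ Ico 0 T := ⟨ht.1, ht.2.trans_lt hT'⟩
  -- Both orders of the pair give equality, so `P t` is locally constant and its derivative `u t r`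
  -- vanishes.
  have hev : P t =ᶠ[𝓝 r] fun _ => P t r := by
    filter_upwards [Icc_mem_nhds hl hr] with ρ hρ
    have k1 := key2 (t, ρ, r) ⟨ht, hρ, hl.le, hr.le⟩
    have k2 := key2 (t, r, ρ) ⟨ht, ⟨hl.le, hr.le⟩, hρ⟩
    simp only at k1 k2
    linarith
  have hd1 : HasDerivAt (P t) (u t r) r := ((hcu t ht').integral_hasStrictDerivAt 0 r).hasDerivAt
  exact hd1.unique ((hasDerivAt_const r (P t r)).congr_of_eventuallyEq hev)

end OneDim

end

/-! ### Compact support of solutions, and the drift in terms of partial masses. -/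

section

variable {b w : ℝ → ℝ} {f₀ : Phase → ℝ} {T : ℝ} {g g₁ g₂ : ℝ → Phase → ℝ}

namespace IsClassicalSolution

theorem contDiffOn_slice (hg : IsClassicalSolution b w f₀ T g) (θ σ : ℝ) :
    ContDiffOn ℝ 1 (uncurry fun t r => g t (θ, σ, r)) (Ico 0 T ×ˢ univ) := by
  have h : ContDiff ℝ 1 fun z : ℝ × ℝ => ((z.1, (θ, σ, z.2)) : ℝ × Phase) := by fun_prop
  exact hg.contDiffOn.comp h.contDiffOn fun z hz => ⟨hz.1, mem_univ _⟩

theorem continuous_time (hg : IsClassicalSolution b w f₀ T g) {t : ℝ} (ht : t ∈ Ico 0 T) :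
    Continuous (g t) :=
  hg.contDiffOn.continuousOn.comp_continuous (f := fun q => (t, q)) (by fun_prop)
    fun _ => ⟨ht, mem_univ _⟩

/-- Finite speed of propagation in the rating variable, for fixed strength and deviation. -/
theorem eq_zero_of_drift_le (hg : IsClassicalSolution b w f₀ T g) {θ σ T' A ℓ R : ℝ}
    (hT' : T' < T) (hA : 0 ≤ A) (hbd : ∀ t ∈ Icc 0 T', ∀ r, |drift b w (g t) θ σ r| ≤ A)
    (h0 : ∀ r ∈ Icc ℓ R, f₀ (θ, σ, r) = 0) {t r : ℝ} (ht : t ∈ Icc 0 T') (hl : ℓ + A * t < r)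
    (hr : r < R - A * t) : g t (θ, σ, r) = 0 := by
  refine eq_zero_of_flux_le (F := fun t r => drift b w (g t) θ σ r * g t (θ, σ, r))
    (hg.contDiffOn_slice θ σ) (fun t ht r => hg.flux_differentiable t ht θ σ r)
    (fun t ht r => hg.equation t ht θ σ r) hT' hA (fun t ht r => ?_) (fun r hr => ?_) ht hl hr
  · rw [abs_mul]
    exact mul_le_mul_of_nonneg_right (hbd t ht r) (abs_nonneg _)
  · rw [hg.initial, h0 r hr]

theorem exists_abs_drift_le (hb : OutcomeFunction b) (hw : RateFunction w)
    (hg : IsClassicalSolution b w f₀ T g) {T' : ℝ} (hT' : T' < T) (θ σ : ℝ) :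
    ∃ A, 0 ≤ A ∧ ∀ t ∈ Icc 0 T', ∀ r, |drift b w (g t) θ σ r| ≤ A := by
  obtain ⟨A, hA, hk⟩ := exists_abs_kernel_le hb hw
  obtain ⟨C, hC⟩ := hg.finiteMoments θ T' hT'
  refine ⟨A * (1 + σ ^ 2) * max C 0, by positivity, fun t ht r => ?_⟩
  obtain ⟨hi, hle⟩ := hC t ht
  rw [drift_eq, ← Real.norm_eq_abs]
  refine (norm_integral_le_of_norm_le (hi.const_mul (A * (1 + σ ^ 2)))
    (.of_forall fun y => ?_)).trans ?_
  · rw [norm_mul, Real.norm_eq_abs, Real.norm_eq_abs, ← mul_assoc]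
    exact mul_le_mul_of_nonneg_right (hk (θ, σ, r) y) (abs_nonneg _)
  · rw [integral_const_mul]
    exact mul_le_mul_of_nonneg_left (hle.trans (le_max_left _ _)) (by positivity)

/-- The speed on a single slice is finite, so an initial interval wide enough for its shrinking cone
to contain the given point can be chosen. -/
theorem eq_zero_of_slice (hb : OutcomeFunction b) (hw : RateFunction w)
    (hg : IsClassicalSolution b w f₀ T g) {θ σ : ℝ} (h0 : ∀ r, f₀ (θ, σ, r) = 0) {t : ℝ}
    (ht : t ∈ Ico 0 T) (r : ℝ) : g t (θ, σ, r) = 0 := by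
  obtain ⟨A, hA, hbd⟩ := exists_abs_drift_le hb hw hg ht.2 θ σ
  exact hg.eq_zero_of_drift_le (ℓ := r - A * t - 1) (R := r + A * t + 1) ht.2 hA hbd
    (fun r _ => h0 r) ⟨ht.1, le_rfl⟩ (by linarith) (by linarith)

/-- A classical solution with compactly supported initial value is supported in a fixed compact
set, locally uniformly in time. -/
theorem exists_support_bound (hb : OutcomeFunction b) (hw : RateFunction w)
    (hf₀ : HasCompactSupport f₀) (hg : IsClassicalSolution b w f₀ T g) {T' : ℝ} (hT' : T' < T) :
    ∃ R, 0 < R ∧ ∀ t ∈ Icc 0 T', ∀ q : Phase, R ≤ ‖q‖ → g t q = 0 := by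
  obtain ⟨R₀, hR₀, hsupp⟩ := hf₀.exists_pos_le_norm
  -- The moment bound is not uniform in `θ`, so the speed bound is at first different for each
  -- slice. Discarding the slices where `f₀` vanishes leaves bounded strengths and deviations, for
  -- which the kernel is bounded and one speed `A` serves all.
  have hsl : ∀ t ∈ Icc 0 T', ∀ q : Phase, R₀ < |q.1| ∨ R₀ < |q.2.1| → g t q = 0 := by
    intro t ht q hq
    refine hg.eq_zero_of_slice hb hw (fun r => hsupp _ ?_) ⟨ht.1, ht.2.trans_lt hT'⟩ q.2.2
    rcases hq with h | h
    · exact h.le.trans (le_max_left _ _)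
    · exact h.le.trans ((le_max_left _ _).trans (le_max_right _ _))
  obtain ⟨B, hB, hk⟩ := exists_abs_kernel_le_of_norm_le hb hw R₀
  -- Any strength would do in place of `0`: the weight is at least `1`, so this bounds the total
  -- mass.
  obtain ⟨C, hC⟩ := hg.finiteMoments 0 T' hT'
  set A := B * max C 0 with hA
  have hA0 : 0 ≤ A := by positivity
  have hdr : ∀ θ σ : ℝ, |θ| ≤ R₀ → |σ| ≤ R₀ → ∀ t ∈ Icc 0 T', ∀ r,
      |drift b w (g t) θ σ r| ≤ A := by
    intro θ σ hθ hσ t ht r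
    obtain ⟨hi, hle⟩ := hC t ht
    rw [drift_eq, ← Real.norm_eq_abs]
    refine (norm_integral_le_of_norm_le (hi.const_mul B) (.of_forall fun y => ?_)).trans ?_
    · rw [norm_mul, Real.norm_eq_abs, Real.norm_eq_abs]
      by_cases hy : R₀ < |y.1| ∨ R₀ < |y.2.1|
      · simp [hsl t ht y hy]
      · push Not at hy
        refine mul_le_mul (hk _ y hθ hσ hy.1 hy.2) ?_ (abs_nonneg _) hB
        refine le_mul_of_one_le_left (abs_nonneg _) ?_
        exact one_le_mul_of_one_le_of_one_le (le_add_of_nonneg_right (abs_nonneg _))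
          (le_add_of_nonneg_right (sq_nonneg _))
    · rw [integral_const_mul]
      exact mul_le_mul_of_nonneg_left (hle.trans (le_max_left _ _)) hB
  -- Initial radius plus distance travelled; the margin `2` gives the strict inequalities at the
  -- edge of the cone. The absolute value keeps the radius positive when `T' < 0`.
  refine ⟨R₀ + A * |T'| + 2, by positivity, fun t ht q hq => ?_⟩
  by_cases h : R₀ < |q.1| ∨ R₀ < |q.2.1|
  · exact hsl t ht q h
  push Not at h
  have hAt : A * t ≤ A * |T'| := by gcongr; exact ht.2.trans (le_abs_self _)
  have hAt0 : 0 ≤ A * t := mul_nonneg hA0 ht.1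
  have hr : R₀ + A * |T'| + 2 ≤ |q.2.2| := by
    by_contra hcon
    push Not at hcon
    refine absurd hq (not_le.2 (max_lt ?_ (max_lt ?_ hcon)))
    · exact h.1.trans_lt (by linarith)
    · exact h.2.trans_lt (by linarith)
  rcases le_abs'.1 hr with h1 | h1
  · refine hg.eq_zero_of_drift_le (θ := q.1) (σ := q.2.1) (r := q.2.2) (R := -R₀ - 1)
      (ℓ := q.2.2 - A * t - 1) hT' hA0 (hdr _ _ h.1 h.2) (fun r hr => hsupp _ ?_) ht
      (by linarith) (by linarith)
    exact le_trans (by rw [le_abs']; left; linarith [hr.2])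
      ((le_max_right |q.2.1| |r|).trans (le_max_right |q.1| _))
  · refine hg.eq_zero_of_drift_le (θ := q.1) (σ := q.2.1) (r := q.2.2) (ℓ := R₀ + 1)
      (R := q.2.2 + A * t + 1) hT' hA0 (hdr _ _ h.1 h.2) (fun r hr => hsupp _ ?_) ht
      (by linarith) (by linarith)
    exact le_trans (by rw [le_abs']; right; linarith [hr.1])
      ((le_max_right |q.2.1| |r|).trans (le_max_right |q.1| _))

end IsClassicalSolution

/-- A function on the line supported in `[-R, R]` and bounded by `c` has integral at most
`c * (2 * R)`. -/
theorem abs_integral_le_of_support {ψ : ℝ → ℝ} {R c : ℝ} (hR : 0 < R)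
    (hψ : ∀ s, R ≤ |s| → ψ s = 0) (hc : ∀ s, |ψ s| ≤ c) : |∫ s, ψ s| ≤ c * (2 * R) := by
  rw [← setIntegral_eq_integral_of_forall_compl_eq_zero (s := Icc (-R) R)]
  · have := norm_setIntegral_le_of_norm_le_const (μ := volume) (s := Icc (-R) R) (f := ψ) (C := c)
      (by simp) (fun s _ => hc s)
    rwa [Real.volume_real_Icc_of_le (by linarith), show R - -R = 2 * R by ring] at this
  · intro s hs
    refine hψ s ?_
    by_contra h
    push Not at h
    exact hs (abs_le.1 h.le)

theorem integral_phase {φ : Phase → ℝ} (hφ : Integrable φ) :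
    ∫ y, φ y = ∫ θ, ∫ σ, ∫ r, φ (θ, σ, r) := by
  have h1 : ∫ y, φ y = ∫ θ, ∫ z : ℝ × ℝ, φ (θ, z) := integral_prod _ hφ
  rw [h1]
  refine integral_congr_ae ?_
  filter_upwards [hφ.prod_right_ae] with θ hθ
  exact integral_prod _ hθ

theorem integrable_of_norm_ge {φ : Phase → ℝ} {R : ℝ} (hφ : Continuous φ)
    (h : ∀ y, R ≤ ‖y‖ → φ y = 0) : Integrable φ := by
  refine hφ.integrable_of_hasCompactSupport
    (HasCompactSupport.intro (isCompact_closedBall (0 : Phase) R) fun y hy => h y ?_)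
  rw [mem_closedBall_zero_iff, not_le] at hy
  exact hy.le

/-- The drift generated by a density is controlled by the partial masses of the density. -/
theorem exists_abs_integral_kernel_le (hb : OutcomeFunction b) (hw : RateFunction w) {R : ℝ}
    (hR : 0 < R) :
    ∃ C, 0 ≤ C ∧ ∀ (h : Phase → ℝ) (N : ℝ) (q : Phase), Continuous h →
      (∀ y, R ≤ ‖y‖ → h y = 0) → ‖q‖ ≤ R →
      (∀ y : Phase, ‖y‖ ≤ R → |∫ s in (-R)..y.2.2, h (y.1, y.2.1, s)| ≤ N) →
      |∫ y, kernel b w q y * h y| ≤ C * N := by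
  have hcK := (isCompact_closedBall (0 : Phase) R).prod (isCompact_closedBall (0 : Phase) R)
  obtain ⟨B₁, hB₁⟩ := hcK.exists_bound_of_continuousOn (contDiff_kernel hb hw).continuous.continuousOn
  obtain ⟨B₂, hB₂⟩ :=
    hcK.exists_bound_of_continuousOn (contDiff_kernelDeriv hb hw).continuous.continuousOn
  have h00 : ((0, 0) : Phase × Phase) ∈ Metric.closedBall (0 : Phase) R ×ˢ Metric.closedBall 0 R :=
    ⟨by simp [hR.le], by simp [hR.le]⟩
  have hB₁0 : 0 ≤ B₁ := (norm_nonneg _).trans (hB₁ _ h00)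
  have hB₂0 : 0 ≤ B₂ := (norm_nonneg _).trans (hB₂ _ h00)
  -- On each line: a boundary term `B₁` and an integral of length `2R` with bound `B₂`; then two
  -- integrations of length `2R` over deviation and strength.
  refine ⟨(B₁ + B₂ * (2 * R)) * (2 * R) * (2 * R), by positivity, fun h N q hc hz hq hN => ?_⟩
  have hN0 : 0 ≤ N := (abs_nonneg _).trans (hN 0 (by simp [hR.le]))
  have hkc : Continuous (kernel b w q) :=
    (contDiff_kernel hb hw).continuous.comp (f := fun y => (q, y)) (by fun_prop)
  have hkc' : Continuous (kernelDeriv b w q) :=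
    (contDiff_kernelDeriv hb hw).continuous.comp (f := fun y => (q, y)) (by fun_prop)
  have hz1 : ∀ y : Phase, R ≤ |y.1| → h y = 0 := fun y hy => hz y (hy.trans (le_max_left _ _))
  have hz2 : ∀ y : Phase, R ≤ |y.2.1| → h y = 0 := fun y hy =>
    hz y (hy.trans ((le_max_left _ _).trans (le_max_right _ _)))
  have hz3 : ∀ y : Phase, R ≤ |y.2.2| → h y = 0 := fun y hy =>
    hz y (hy.trans ((le_max_right _ _).trans (le_max_right _ _)))
  rw [integral_phase (φ := fun y => kernel b w q y * h y)
    (integrable_of_norm_ge (R := R) (hkc.mul hc) fun y hy => by rw [hz y hy, mul_zero])]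
  have inner : ∀ θ σ : ℝ,
      |∫ r, kernel b w q (θ, σ, r) * h (θ, σ, r)| ≤ (B₁ + B₂ * (2 * R)) * N := by
    intro θ σ
    by_cases hθσ : R ≤ |θ| ∨ R ≤ |σ|
    · have : ∀ r, h (θ, σ, r) = 0 := fun r => by
        rcases hθσ with h | h
        · exact hz1 _ h
        · exact hz2 _ h
      simp only [this, mul_zero, integral_zero, abs_zero]
      positivity
    push Not at hθσ
    have hball : ∀ r ∈ Icc (-R) R, ‖((θ, σ, r) : Phase)‖ ≤ R := fun r hr =>
      max_le hθσ.1.le (max_le hθσ.2.le (abs_le.2 hr))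
    set G : ℝ → ℝ := fun r => ∫ s in (-R)..r, h (θ, σ, s) with hG
    have hGd : ∀ r, HasDerivAt G (h (θ, σ, r)) r := fun r =>
      ((by fun_prop : Continuous fun s => h (θ, σ, s)).integral_hasStrictDerivAt (-R) r).hasDerivAt
    have e1 : ∫ r, kernel b w q (θ, σ, r) * h (θ, σ, r) =
        ∫ r in (-R)..R, kernel b w q (θ, σ, r) * h (θ, σ, r) := by
      rw [intervalIntegral.integral_of_le (by linarith), ← integral_Icc_eq_integral_Ioc,
        setIntegral_eq_integral_of_forall_compl_eq_zero]
      intro r hr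
      rw [hz3 (θ, σ, r), mul_zero]
      by_contra hcon
      push Not at hcon
      exact hr (abs_le.1 hcon.le)
    -- Integration by parts moves the rating derivative from the partial mass `G` to the kernel.
    have e2 := intervalIntegral.integral_mul_deriv_eq_deriv_mul (a := -R) (b := R)
      (u := fun r => kernel b w q (θ, σ, r)) (v := G)
      (fun r _ => hasDerivAt_kernel_right hb hw q θ σ r) (fun r _ => hGd r)
      (Continuous.intervalIntegrable (by fun_prop) _ _)
      (Continuous.intervalIntegrable (by fun_prop) _ _)
    have hG0 : G (-R) = 0 := intervalIntegral.integral_same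
    have hGN : ∀ r ∈ Icc (-R) R, |G r| ≤ N := fun r hr => hN (θ, σ, r) (hball r hr)
    rw [e1, e2, hG0, mul_zero, sub_zero]
    have hRm : R ∈ Icc (-R) R := ⟨by linarith, le_rfl⟩
    have b1 : |kernel b w q (θ, σ, R) * G R| ≤ B₁ * N := by
      rw [abs_mul]
      exact mul_le_mul (hB₁ (q, (θ, σ, R)) ⟨by simpa using hq, by simpa using hball R hRm⟩)
        (hGN R hRm) (abs_nonneg _) hB₁0
    have b2 : ‖∫ r in (-R)..R, -kernelDeriv b w q (θ, σ, r) * G r‖ ≤ B₂ * N * |R - -R| := by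
      refine intervalIntegral.norm_integral_le_of_norm_le_const fun r hr => ?_
      have hr' : r ∈ Icc (-R) R := by
        rw [uIoc_of_le (by linarith)] at hr
        exact Ioc_subset_Icc_self hr
      rw [norm_mul, norm_neg]
      exact mul_le_mul (hB₂ (q, (θ, σ, r)) ⟨by simpa using hq, by simpa using hball r hr'⟩)
        (hGN r hr') (abs_nonneg _) hB₂0
    rw [Real.norm_eq_abs, abs_of_pos (by linarith : 0 < R - -R)] at b2
    refine (abs_sub _ _).trans ?_
    nlinarith
  have mid : ∀ θ : ℝ, |∫ σ, ∫ r, kernel b w q (θ, σ, r) * h (θ, σ, r)| ≤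
      (B₁ + B₂ * (2 * R)) * N * (2 * R) := fun θ =>
    abs_integral_le_of_support hR (fun σ hσ => by
      have : ∀ r, h (θ, σ, r) = 0 := fun r => hz2 _ hσ
      simp [this]) (inner θ)
  have outer := abs_integral_le_of_support hR (fun θ hθ => by
      have : ∀ σ r, h (θ, σ, r) = 0 := fun σ r => hz1 _ hθ
      simp [this]) mid
  refine outer.trans (le_of_eq ?_)
  ring

end

/-! ### Uniqueness. -/

section

variable {b w : ℝ → ℝ} {f₀ : Phase → ℝ} {T : ℝ} {g₁ g₂ : ℝ → Phase → ℝ}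

/-- Classical solutions with the same compactly supported initial value agree. -/
theorem IsClassicalSolution.unique (hb : OutcomeFunction b) (hw : RateFunction w)
    (hf₀ : HasCompactSupport f₀) (h₁ : IsClassicalSolution b w f₀ T g₁)
    (h₂ : IsClassicalSolution b w f₀ T g₂) {T' : ℝ} (hT0 : 0 ≤ T') (hT' : T' < T) (q : Phase) :
    g₁ T' q = g₂ T' q := by
  obtain ⟨R₁, hR₁, hs₁⟩ := h₁.exists_support_bound hb hw hf₀ hT'
  obtain ⟨R₂, hR₂, hs₂⟩ := h₂.exists_support_bound hb hw hf₀ hT'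
  set R := max R₁ R₂ with hR
  have hR0 : 0 < R := lt_max_of_lt_left hR₁
  have z₁ : ∀ t ∈ Icc 0 T', ∀ q : Phase, R ≤ ‖q‖ → g₁ t q = 0 := fun t ht q hq =>
    hs₁ t ht q ((le_max_left _ _).trans hq)
  have z₂ : ∀ t ∈ Icc 0 T', ∀ q : Phase, R ≤ ‖q‖ → g₂ t q = 0 := fun t ht q hq =>
    hs₂ t ht q ((le_max_right _ _).trans hq)
  have hsub : Icc 0 T' ⊆ Ico 0 T := fun t ht => ⟨ht.1, ht.2.trans_lt hT'⟩
  obtain ⟨C, hC0, hC⟩ := exists_abs_integral_kernel_le hb hw hR0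
  obtain ⟨B, hB⟩ := ((isCompact_Icc (a := (0 : ℝ)) (b := T')).prod
    (isCompact_closedBall (0 : Phase) R)).exists_bound_of_continuousOn
      (h₂.contDiffOn.continuousOn.mono (prod_mono hsub (subset_univ _)))
  have hB0 : 0 ≤ B := (norm_nonneg _).trans (hB (0, 0) ⟨⟨le_rfl, hT0⟩, by simp [hR0.le]⟩)
  set G : ℝ → Phase → ℝ := fun t q => ∫ s in (-R)..q.2.2,
    (g₁ t (q.1, q.2.1, s) - g₂ t (q.1, q.2.1, s)) with hG
  have hhc : ∀ t ∈ Icc 0 T', Continuous fun q => g₁ t q - g₂ t q := fun t ht =>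
    (h₁.continuous_time (hsub ht)).sub (h₂.continuous_time (hsub ht))
  have hGr : ∀ t ∈ Icc 0 T', ∀ θ σ r : ℝ, HasDerivAt (fun ρ => G t (θ, σ, ρ))
      (g₁ t (θ, σ, r) - g₂ t (θ, σ, r)) r := by
    intro t ht θ σ r
    have c : Continuous fun s => g₁ t (θ, σ, s) - g₂ t (θ, σ, s) :=
      (hhc t ht).comp (f := fun s => (θ, σ, s)) (by fun_prop)
    exact (c.integral_hasStrictDerivAt (-R) r).hasDerivAt
  have hGcont : ContinuousOn (uncurry G) (Icc 0 T' ×ˢ univ) := by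
    have c : ∀ {g : ℝ → Phase → ℝ}, IsClassicalSolution b w f₀ T g →
        Continuous fun z : ℝ × Phase => g (projIcc 0 T' hT0 z.1) z.2 := fun h =>
      h.contDiffOn.continuousOn.comp_continuous
        (f := fun z : ℝ × Phase => ((projIcc 0 T' hT0 z.1 : ℝ), z.2)) (by fun_prop)
        fun z => ⟨hsub (projIcc 0 T' hT0 z.1).2, mem_univ _⟩
    have c' := (c h₁).sub (c h₂)
    have h1 : Continuous (uncurry fun (z : ℝ × Phase) (s : ℝ) =>
        g₁ (projIcc 0 T' hT0 z.1) (z.2.1, z.2.2.1, s) -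
          g₂ (projIcc 0 T' hT0 z.1) (z.2.1, z.2.2.1, s)) :=
      c'.comp (f := fun v : (ℝ × Phase) × ℝ => (v.1.1, (v.1.2.1, v.1.2.2.1, v.2))) (by fun_prop)
    have h2 := intervalIntegral.continuous_parametric_intervalIntegral_of_continuous
      (μ := volume) (a₀ := -R) h1 (s := fun z => z.2.2.2) (by fun_prop)
    refine h2.continuousOn.congr fun z hz => ?_
    simp only [projIcc_of_mem hT0 hz.1, uncurry, hG]
  -- `C` relates the drift difference to `max |G|` and `B` bounds `g₂`; exceeding `C * B` makes the
  -- inequality at a nonzero maximum impossible.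
  set l : ℝ := C * B + 1 with hl
  have hmaxc : ContinuousOn (fun z : ℝ × Phase => Real.exp (-(l * z.1)) * |G z.1 z.2|)
      (Icc 0 T' ×ˢ Metric.closedBall 0 R) :=
    ContinuousOn.mul (by fun_prop) (hGcont.mono (prod_mono_right (subset_univ _))).abs
  obtain ⟨⟨t₀, q₀⟩, ⟨ht₀, hq₀⟩, hmax⟩ := ((isCompact_Icc (a := (0 : ℝ)) (b := T')).prod
    (isCompact_closedBall (0 : Phase) R)).exists_isMaxOn
      ⟨(0, 0), ⟨le_rfl, hT0⟩, by simp [hR0.le]⟩ hmaxc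
  simp only [mem_closedBall_zero_iff] at ht₀ hq₀
  have hle : ∀ t ∈ Icc 0 T', ∀ q : Phase, ‖q‖ ≤ R →
      Real.exp (-(l * t)) * |G t q| ≤ Real.exp (-(l * t₀)) * |G t₀ q₀| := fun t ht q hq =>
    hmax (a := (t, q)) ⟨ht, by simpa using hq⟩
  have hG0 : G t₀ q₀ = 0 := by
    by_contra hne
    have ht₀p : 0 < t₀ := by
      refine ht₀.1.lt_of_ne fun h => hne ?_
      simp [hG, ← h, h₁.initial, h₂.initial]
    have ht₀' : t₀ ∈ Ioo 0 T := ⟨ht₀p, (hsub ht₀).2⟩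
    set e : ℝ := (SignType.sign (G t₀ q₀) : ℝ) with he
    have heG : e * G t₀ q₀ = |G t₀ q₀| := sign_mul_self _
    have hee : e * e = 1 := by
      rcases lt_or_gt_of_ne hne with h | h <;> simp [he, h]
    have heabs : ∀ x, e * x ≤ |x| := by
      intro x
      refine (le_abs_self _).trans_eq ?_
      rw [abs_mul, show |e| = 1 by rcases lt_or_gt_of_ne hne with h | h <;> simp [he, h], one_mul]
    obtain ⟨θ, σ, r⟩ := q₀
    -- On the boundary of the ball both solutions vanish; inside, the maximum is critical in the
    -- rating and the derivative of `G` there is `g₁ - g₂`.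
    have heq : g₁ t₀ (θ, σ, r) = g₂ t₀ (θ, σ, r) := by
      rcases hq₀.eq_or_lt with h | h
      · rw [z₁ t₀ ht₀ _ h.ge, z₂ t₀ ht₀ _ h.ge]
      · have hcts : Continuous fun ρ : ℝ => ‖((θ, σ, ρ) : Phase)‖ := by fun_prop
        have hloc : IsLocalMax (fun ρ => e * G t₀ (θ, σ, ρ)) r := by
          filter_upwards [(hcts.tendsto r).eventually_lt_const h] with ρ hρ
          rw [heG]
          refine (heabs _).trans ?_
          exact le_of_mul_le_mul_left (hle t₀ ht₀ _ hρ.le) (Real.exp_pos _)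
        have := hloc.hasDerivAt_eq_zero ((hGr t₀ ht₀ θ σ r).const_mul e)
        have e0 : e ≠ 0 := fun h => by simp [h] at hee
        linarith [(mul_eq_zero.1 this).resolve_left e0]
    set a₁ := drift b w (g₁ t₀) θ σ r
    set a₂ := drift b w (g₂ t₀) θ σ r
    have hdG : HasDerivAt (fun t => G t (θ, σ, r)) (-((a₁ - a₂) * g₂ t₀ (θ, σ, r))) t₀ := by
      have d : ∀ {g : ℝ → Phase → ℝ}, IsClassicalSolution b w f₀ T g →
          (∀ q : Phase, R ≤ ‖q‖ → g t₀ q = 0) →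
          HasDerivAt (fun t => (∫ s in (0 : ℝ)..r, g t (θ, σ, s)) -
            ∫ s in (0 : ℝ)..(-R), g t (θ, σ, s))
            (-(drift b w (g t₀) θ σ r * g t₀ (θ, σ, r))) t₀ := by
        intro g hg hz
        have k : ∀ ρ, HasDerivAt (fun t => ∫ s in (0 : ℝ)..ρ, g t (θ, σ, s))
            (-(drift b w (g t₀) θ σ ρ * g t₀ (θ, σ, ρ) -
              drift b w (g t₀) θ σ 0 * g t₀ (θ, σ, 0))) t₀ := by
          intro ρ
          have m := hasFDerivAt_mass (F := fun t r => drift b w (g t) θ σ r * g t (θ, σ, r))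
            (hg.contDiffOn_slice θ σ) (fun t ht r => hg.flux_differentiable t ht θ σ r)
            (fun t ht r => hg.equation t ht θ σ r) ht₀' ρ
          have m' := m.comp_hasDerivAt (f := fun t : ℝ => (t, ρ)) t₀
            ((hasDerivAt_id t₀).prodMk (hasDerivAt_const t₀ ρ))
          convert! m' using 1
          simp
        -- No flux enters at the lower end of the partial mass.
        have hzR : g t₀ (θ, σ, -R) = 0 := by
          refine hz _ (le_trans ?_ ((le_max_right |σ| |-R|).trans (le_max_right |θ| _)))
          rw [abs_neg]
          exact le_abs_self R
        convert! (k r).sub (k (-R)) using 1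
        rw [hzR]
        ring
      have d₁ := d h₁ (z₁ t₀ ht₀)
      have d₂ := d h₂ (z₂ t₀ ht₀)
      have d₃ := d₁.sub d₂
      refine HasDerivAt.congr_of_eventuallyEq (f₁ := fun t => G t (θ, σ, r))
        (by convert! d₃ using 1; rw [heq]; ring) ?_
      filter_upwards [Ioo_mem_nhds ht₀'.1 ht₀'.2] with t ht
      have c₁ := h₁.continuous_time (Ioo_subset_Ico_self ht)
      have c₂ := h₂.continuous_time (Ioo_subset_Ico_self ht)
      have i₁ : ∀ a c : ℝ, IntervalIntegrable (fun s => g₁ t (θ, σ, s)) volume a c :=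
        fun a c => Continuous.intervalIntegrable (by fun_prop) _ _
      have i₂ : ∀ a c : ℝ, IntervalIntegrable (fun s => g₂ t (θ, σ, s)) volume a c :=
        fun a c => Continuous.intervalIntegrable (by fun_prop) _ _
      simp only [hG, Pi.sub_apply]
      rw [intervalIntegral.integral_sub (i₁ _ _) (i₂ _ _),
        intervalIntegral.integral_interval_sub_left (i₁ _ _) (i₁ _ _),
        intervalIntegral.integral_interval_sub_left (i₂ _ _) (i₂ _ _)]
    have hexp : HasDerivAt (fun t => Real.exp (-(l * t))) (Real.exp (-(l * t₀)) * -l) t₀ := by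
      have := ((hasDerivAt_id t₀).const_mul l).neg.exp
      simpa using this
    have hψ := (hexp.mul (hdG.const_mul e))
    have hψ' : HasDerivAt (fun δ => Real.exp (-(l * (t₀ - δ))) * (e * G (t₀ - δ) (θ, σ, r)))
        (-(Real.exp (-(l * t₀)) * -l * (e * G t₀ (θ, σ, r)) +
          Real.exp (-(l * t₀)) * (e * -((a₁ - a₂) * g₂ t₀ (θ, σ, r))))) 0 :=
      HasDerivAt.comp_const_sub t₀ 0 (by rw [sub_zero]; exact hψ)
    have hnp := HasDerivAt.nonpos_of_forall_le hψ' ht₀p fun δ hδ => by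
      rw [sub_zero, heG]
      refine le_trans ?_ (hle (t₀ - δ) ⟨by linarith [hδ.2], by linarith [hδ.1, ht₀.2]⟩ _ hq₀)
      exact mul_le_mul_of_nonneg_left (heabs _) (Real.exp_pos _).le
    have hdiff : |a₁ - a₂| ≤ C * |G t₀ (θ, σ, r)| := by
      have hint : ∀ {g : Phase → ℝ}, Continuous g → (∀ q : Phase, R ≤ ‖q‖ → g q = 0) →
          Integrable fun y => kernel b w (θ, σ, r) y * g y := fun hg hz =>
        integrable_of_norm_ge (R := R)
          (((contDiff_kernel hb hw).continuous.comp (f := fun y => ((θ, σ, r), y))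
            (by fun_prop)).mul hg) fun y hy => by rw [hz y hy, mul_zero]
      have e1 : a₁ - a₂ = ∫ y, kernel b w (θ, σ, r) y * (g₁ t₀ y - g₂ t₀ y) := by
        simp only [a₁, a₂, drift_eq, mul_sub]
        exact (integral_sub (hint (h₁.continuous_time (hsub ht₀)) (z₁ t₀ ht₀))
          (hint (h₂.continuous_time (hsub ht₀)) (z₂ t₀ ht₀))).symm
      rw [e1]
      refine hC _ _ _ (hhc t₀ ht₀) (fun y hy => ?_) hq₀ fun y hy => ?_
      · rw [z₁ t₀ ht₀ y hy, z₂ t₀ ht₀ y hy, sub_zero]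
      · exact le_of_mul_le_mul_left (hle t₀ ht₀ y hy) (Real.exp_pos _)
    have hg₂ : |g₂ t₀ (θ, σ, r)| ≤ B := hB (t₀, (θ, σ, r)) ⟨ht₀, by simpa using hq₀⟩
    have hpos : 0 < |G t₀ (θ, σ, r)| := abs_pos.2 hne
    rw [heG] at hnp
    have k1 : l * |G t₀ (θ, σ, r)| ≤ e * -((a₁ - a₂) * g₂ t₀ (θ, σ, r)) := by
      have hp := Real.exp_pos (-(l * t₀))
      refine le_of_mul_le_mul_left ?_ hp
      linarith
    have k2 : e * -((a₁ - a₂) * g₂ t₀ (θ, σ, r)) ≤ C * |G t₀ (θ, σ, r)| * B := by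
      refine (heabs _).trans ?_
      rw [abs_neg, abs_mul]
      exact mul_le_mul hdiff hg₂ (abs_nonneg _) (by positivity)
    rw [hl] at k1
    linarith
  have hGall : ∀ q : Phase, ‖q‖ ≤ R → G T' q = 0 := by
    intro q hq
    have := hle T' ⟨hT0, le_rfl⟩ q hq
    rw [hG0, abs_zero, mul_zero] at this
    exact abs_nonpos_iff.1 (nonpos_of_mul_nonpos_right this (Real.exp_pos _))
  have hT'm : T' ∈ Icc 0 T' := ⟨hT0, le_rfl⟩
  rcases le_or_gt R ‖q‖ with h | h
  · rw [z₁ T' hT'm q h, z₂ T' hT'm q h]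
  · obtain ⟨θ, σ, r⟩ := q
    have hcts : Continuous fun ρ : ℝ => ‖((θ, σ, ρ) : Phase)‖ := by fun_prop
    have hev : (fun ρ => G T' (θ, σ, ρ)) =ᶠ[𝓝 r] fun _ => 0 := by
      filter_upwards [(hcts.tendsto r).eventually_lt_const h] with ρ hρ using hGall _ hρ.le
    have := (hGr T' hT'm θ σ r).unique ((hasDerivAt_const r (0 : ℝ)).congr_of_eventuallyEq hev)
    linarith

end

/-! ### Trajectories of a regular field and their dependence on the initial point. -/

section

/-- The solution of a scalar linear equation by the variation of constants formula. -/
theorem eq_of_hasDerivWithinAt_linear {T : ℝ} {m c δ : ℝ → ℝ} (hm : Continuous m)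
    (hc : Continuous c)
    (hδ : ∀ t ∈ Icc (-T) T, HasDerivWithinAt δ (m t * δ t + c t) (Icc (-T) T) t) {t : ℝ}
    (ht : t ∈ Icc (-T) T) :
    δ t = Real.exp (∫ s in (0 : ℝ)..t, m s) *
      (δ 0 + ∫ s in (0 : ℝ)..t, Real.exp (-∫ u in (0 : ℝ)..s, m u) * c s) := by
  have hμ : ∀ t, HasDerivAt (fun t => ∫ s in (0 : ℝ)..t, m s) (m t) t := fun t =>
    (hm.integral_hasStrictDerivAt 0 t).hasDerivAt
  have hμc : Continuous fun t => ∫ s in (0 : ℝ)..t, m s :=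
    continuous_iff_continuousAt.2 fun t => (hμ t).continuousAt
  set η : ℝ → ℝ := fun t => Real.exp (-∫ s in (0 : ℝ)..t, m s) * δ t with hη
  have hηd : ∀ t ∈ Icc (-T) T, HasDerivWithinAt η
      (Real.exp (-∫ u in (0 : ℝ)..t, m u) * c t) (Icc (-T) T) t := by
    intro t ht
    have h1 := ((hμ t).neg.exp.hasDerivWithinAt (s := Icc (-T) T)).mul (hδ t ht)
    convert! h1 using 1
    simp only [Pi.neg_apply]
    ring
  have hT : (0 : ℝ) ∈ Icc (-T) T := by
    have : -T ≤ T := ht.1.trans ht.2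
    constructor <;> linarith
  have hsub : uIcc 0 t ⊆ Icc (-T) T := uIcc_subset_Icc hT ht
  have key := intervalIntegral.integral_eq_sub_of_hasDeriv_right (a := 0) (b := t) (f := η)
    (f' := fun t => Real.exp (-∫ u in (0 : ℝ)..t, m u) * c t)
    (fun s hs => ((hηd s (hsub hs)).continuousWithinAt).mono hsub)
    (fun s hs => by
      have h1 : -T ≤ min 0 t := le_min hT.1 ht.1
      have h2 : max 0 t ≤ T := max_le hT.2 ht.2
      exact ((hηd s ⟨h1.trans hs.1.le, hs.2.le.trans h2⟩).hasDerivAt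
        (Icc_mem_nhds (h1.trans_lt hs.1) (hs.2.trans_le h2))).hasDerivWithinAt)
    (Continuous.intervalIntegrable (by fun_prop) _ _)
  rw [key]
  simp only [hη, intervalIntegral.integral_same, neg_zero, Real.exp_zero, one_mul,
    add_sub_cancel, ← mul_assoc, ← Real.exp_add]
  simp

/-- A time dependent drift in the rating variable that is continuously differentiable and whose
derivative in the rating is continuously differentiable. -/
structure IsRegularField (a : ℝ → Phase → ℝ) (a' a'' : ℝ → Phase → Phase →L[ℝ] ℝ) : Prop where
  continuous : Continuous (uncurry a)
  continuous_deriv : Continuous (uncurry a')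
  continuous_deriv₂ : Continuous (uncurry a'')
  hasFDerivAt : ∀ t q, HasFDerivAt (a t) (a' t q) q
  hasFDerivAt₂ : ∀ t q, HasFDerivAt (fun q => a' t q (0, 0, 1)) (a'' t q) q
  bounded : ∀ R : ℝ, ∃ B, 0 ≤ B ∧ ∀ t q, |q.1| ≤ R → |q.2.1| ≤ R → |a t q| ≤ B

/-- The mean of the derivative of a field along a segment. -/
def meanDeriv (a' : ℝ → Phase → Phase →L[ℝ] ℝ) (t : ℝ) (q q' : Phase) : Phase →L[ℝ] ℝ :=
  ∫ τ in (0 : ℝ)..1, a' t (q + τ • (q' - q))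

theorem meanDeriv_self (a' : ℝ → Phase → Phase →L[ℝ] ℝ) (t : ℝ) (q : Phase) :
    meanDeriv a' t q q = a' t q := by
  simp [meanDeriv]

/-- The trajectories of a field, stopped outside `[-T, T]`. -/
structure IsFlow (a : ℝ → Phase → ℝ) (T : ℝ) (X : ℝ → Phase → ℝ) : Prop where
  zero : ∀ q, X 0 q = q.2.2
  hasDerivWithinAt : ∀ q, ∀ t ∈ Icc (-T) T,
    HasDerivWithinAt (fun t => X t q) (a t (q.1, q.2.1, X t q)) (Icc (-T) T) t
  clamp : ∀ t q, X t q = X (max (-T) (min T t)) q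

/-- The derivative of the flow in the slope form of Hadamard. -/
def flowSlope (a' : ℝ → Phase → Phase →L[ℝ] ℝ) (X : ℝ → Phase → ℝ) (t : ℝ) (q q' : Phase) :
    Phase →L[ℝ] ℝ :=
  Real.exp (∫ s in (0 : ℝ)..t,
      meanDeriv a' s (q.1, q.2.1, X s q) (q'.1, q'.2.1, X s q') (0, 0, 1)) •
    ((ContinuousLinearMap.snd ℝ ℝ ℝ).comp (ContinuousLinearMap.snd ℝ ℝ (ℝ × ℝ)) +
      ∫ s in (0 : ℝ)..t, Real.exp (-∫ u in (0 : ℝ)..s,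
        meanDeriv a' u (q.1, q.2.1, X u q) (q'.1, q'.2.1, X u q') (0, 0, 1)) •
        (meanDeriv a' s (q.1, q.2.1, X s q) (q'.1, q'.2.1, X s q')).comp
          ((ContinuousLinearMap.fst ℝ ℝ (ℝ × ℝ)).prod
            (((ContinuousLinearMap.fst ℝ ℝ ℝ).comp (ContinuousLinearMap.snd ℝ ℝ (ℝ × ℝ))).prod 0)))

theorem clamp_mem {T : ℝ} (hT : 0 ≤ T) (t : ℝ) : max (-T) (min T t) ∈ Icc (-T) T :=
  ⟨le_max_left _ _, max_le (by linarith) (min_le_left _ _)⟩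

theorem clamp_of_mem {T t : ℝ} (ht : t ∈ Icc (-T) T) : max (-T) (min T t) = t := by
  rw [min_eq_right ht.2, max_eq_right ht.1]

namespace IsRegularField

variable {a : ℝ → Phase → ℝ} {a' a'' : ℝ → Phase → Phase →L[ℝ] ℝ} {T : ℝ} {X : ℝ → Phase → ℝ}

theorem continuous_meanDeriv (ha : IsRegularField a a' a'') :
    Continuous fun z : ℝ × Phase × Phase => meanDeriv a' z.1 z.2.1 z.2.2 := by
  have h : Continuous (uncurry fun (z : ℝ × Phase × Phase) (τ : ℝ) =>
      a' z.1 (z.2.1 + τ • (z.2.2 - z.2.1))) :=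
    ha.continuous_deriv.comp (f := fun v : (ℝ × Phase × Phase) × ℝ =>
      (v.1.1, v.1.2.1 + v.2 • (v.1.2.2 - v.1.2.1))) (by fun_prop)
  exact intervalIntegral.continuous_parametric_intervalIntegral_of_continuous' h 0 1

theorem sub_eq_meanDeriv (ha : IsRegularField a a' a'') (t : ℝ) (q q' : Phase) :
    a t q' - a t q = meanDeriv a' t q q' (q' - q) := by
  have hc : Continuous fun τ : ℝ => a' t (q + τ • (q' - q)) :=
    ha.continuous_deriv.comp (f := fun τ : ℝ => (t, q + τ • (q' - q))) (by fun_prop)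
  rw [meanDeriv, ContinuousLinearMap.intervalIntegral_apply (hc.intervalIntegrable _ _)]
  rw [intervalIntegral.integral_eq_sub_of_hasDerivAt
    (f := fun τ : ℝ => a t (q + τ • (q' - q))) (fun τ _ => ?_)
    ((hc.clm_apply continuous_const).intervalIntegrable _ _)]
  · simp
  · have h1 : HasDerivAt (fun τ : ℝ => q + τ • (q' - q)) (q' - q) τ := by
      simpa using ((hasDerivAt_id τ).smul_const (q' - q)).const_add q
    exact (ha.hasFDerivAt t _).comp_hasDerivAt τ h1

/-- The speed is bounded by `B` for all ratings, so a Picard ball of radius `B * T` suffices for the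
whole interval; on that ball the field is Lipschitz by compactness. -/
theorem exists_trajectory (ha : IsRegularField a a' a'') (hT : 0 ≤ T) (q : Phase) :
    ∃ ξ : ℝ → ℝ, ξ 0 = q.2.2 ∧ ∀ t ∈ Icc (-T) T,
      HasDerivWithinAt ξ (a t (q.1, q.2.1, ξ t)) (Icc (-T) T) t := by
  obtain ⟨B, hB, hab⟩ := ha.bounded (max |q.1| |q.2.1|)
  have hat : ∀ t x, |a t (q.1, q.2.1, x)| ≤ B := fun t x =>
    hab t _ (le_max_left _ _) (le_max_right _ _)
  have hdx : ∀ t x, HasDerivAt (fun x => a t (q.1, q.2.1, x)) (a' t (q.1, q.2.1, x) (0, 0, 1)) x :=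
    fun t x => (ha.hasFDerivAt t _).comp_hasDerivAt x
      ((hasDerivAt_const x q.1).prodMk ((hasDerivAt_const x q.2.1).prodMk (hasDerivAt_id x)))
  have hcd : Continuous fun z : ℝ × ℝ => a' z.1 (q.1, q.2.1, z.2) (0, 0, 1) :=
    (ha.continuous_deriv.comp (f := fun z : ℝ × ℝ => (z.1, (q.1, q.2.1, z.2)))
      (by fun_prop)).clm_apply continuous_const
  obtain ⟨K, hK⟩ := ((isCompact_Icc (a := -T) (b := T)).prod
    (isCompact_closedBall q.2.2 (B * T))).exists_bound_of_continuousOn hcd.continuousOn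
  have hpl : IsPicardLindelof (fun t x => a t (q.1, q.2.1, x)) (tmin := -T) (tmax := T)
      ⟨0, by constructor <;> linarith⟩ q.2.2 ⟨B * T, by positivity⟩ 0 ⟨B, hB⟩ K.toNNReal := by
    refine ⟨fun t ht => ?_, fun x _ => ?_, fun t _ x _ => hat t x, ?_⟩
    · refine (convex_closedBall _ _).lipschitzOnWith_of_nnnorm_hasDerivWithin_le
        (fun x _ => (hdx t x).hasDerivWithinAt) fun x hx => ?_
      rw [← NNReal.coe_le_coe, coe_nnnorm]
      exact (hK (t, x) ⟨ht, hx⟩).trans (Real.le_coe_toNNReal K)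
    · exact (ha.continuous.comp (f := fun t : ℝ => (t, (q.1, q.2.1, x)))
        (by fun_prop)).continuousOn
    · simp only [sub_zero, zero_sub, neg_neg, max_self, NNReal.coe_zero]
      exact le_rfl
  obtain ⟨ξ, h0, hξ⟩ := hpl.exists_eq_forall_mem_Icc_hasDerivWithinAt₀
  exact ⟨ξ, h0, hξ⟩

theorem exists_isFlow (ha : IsRegularField a a' a'') (hT : 0 ≤ T) : ∃ X, IsFlow a T X := by
  choose ξ h0 hξ using fun q => ha.exists_trajectory hT q
  have h0m : (0 : ℝ) ∈ Icc (-T) T := by constructor <;> linarith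
  refine ⟨fun t q => ξ q (max (-T) (min T t)), fun q => ?_, fun q t ht => ?_, fun t q => ?_⟩
  · simp only [clamp_of_mem h0m, h0]
  · simp only [clamp_of_mem ht]
    exact (hξ q t ht).congr_of_mem (fun s hs => by simp only [clamp_of_mem hs]) ht
  · simp only [clamp_of_mem (clamp_mem hT t)]

end IsRegularField

namespace IsFlow

variable {a : ℝ → Phase → ℝ} {a' a'' : ℝ → Phase → Phase →L[ℝ] ℝ} {T : ℝ} {X : ℝ → Phase → ℝ}

theorem continuous_time (hX : IsFlow a T X) (hT : 0 ≤ T) (q : Phase) :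
    Continuous fun t => X t q := by
  have h1 : ContinuousOn (fun t => X t q) (Icc (-T) T) := fun t ht =>
    (hX.hasDerivWithinAt q t ht).continuousWithinAt
  have h2 : Continuous fun t : ℝ => X (max (-T) (min T t)) q :=
    h1.comp_continuous (f := fun t : ℝ => max (-T) (min T t)) (by fun_prop)
      fun t => clamp_mem hT t
  exact h2.congr fun t => (hX.clamp t q).symm

theorem abs_sub_le (hX : IsFlow a T X) (hT : 0 ≤ T) {q : Phase} {B : ℝ} (hB : 0 ≤ B)
    (hab : ∀ t x, |a t (q.1, q.2.1, x)| ≤ B) (t : ℝ) : |X t q - q.2.2| ≤ B * T := by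
  rw [hX.clamp, ← hX.zero q]
  have h0m : (0 : ℝ) ∈ Icc (-T) T := by constructor <;> linarith
  have h := (convex_Icc (-T) T).norm_image_sub_le_of_norm_hasDerivWithin_le
    (fun t ht => hX.hasDerivWithinAt q t ht) (fun t _ => hab t _) h0m (clamp_mem hT t)
  refine h.trans (mul_le_mul_of_nonneg_left ?_ hB)
  rw [sub_zero]
  exact abs_le.2 (clamp_mem hT t)

/-- By Hadamard's formula the gap between two trajectories solves a scalar linear equation, forced
by the differences in strength and deviation. Uniqueness, Lipschitz dependence and differentiability
of the flow are all read off from its explicit solution. -/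
theorem sub_eq_of_hasDerivWithinAt (ha : IsRegularField a a' a'') {q q' : Phase} {ξ ξ' : ℝ → ℝ}
    (hc : Continuous ξ) (hc' : Continuous ξ')
    (hξ : ∀ t ∈ Icc (-T) T, HasDerivWithinAt ξ (a t (q.1, q.2.1, ξ t)) (Icc (-T) T) t)
    (hξ' : ∀ t ∈ Icc (-T) T, HasDerivWithinAt ξ' (a t (q'.1, q'.2.1, ξ' t)) (Icc (-T) T) t)
    {t : ℝ} (ht : t ∈ Icc (-T) T) :
    ξ' t - ξ t = Real.exp (∫ s in (0 : ℝ)..t,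
        meanDeriv a' s (q.1, q.2.1, ξ s) (q'.1, q'.2.1, ξ' s) (0, 0, 1)) *
      (ξ' 0 - ξ 0 + ∫ s in (0 : ℝ)..t, Real.exp (-∫ u in (0 : ℝ)..s,
        meanDeriv a' u (q.1, q.2.1, ξ u) (q'.1, q'.2.1, ξ' u) (0, 0, 1)) *
        meanDeriv a' s (q.1, q.2.1, ξ s) (q'.1, q'.2.1, ξ' s)
          (q'.1 - q.1, q'.2.1 - q.2.1, 0)) := by
  have hM : Continuous fun s => meanDeriv a' s (q.1, q.2.1, ξ s) (q'.1, q'.2.1, ξ' s) :=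
    ha.continuous_meanDeriv.comp (f := fun s : ℝ =>
      (s, ((q.1, q.2.1, ξ s), (q'.1, q'.2.1, ξ' s)))) (by fun_prop)
  refine eq_of_hasDerivWithinAt_linear (δ := fun t => ξ' t - ξ t)
    (hM.clm_apply continuous_const) (hM.clm_apply continuous_const) (fun t ht => ?_) ht
  convert! (hξ' t ht).sub (hξ t ht) using 1
  rw [ha.sub_eq_meanDeriv]
  have e : ((q'.1, q'.2.1, ξ' t) : Phase) - (q.1, q.2.1, ξ t) =
      (ξ' t - ξ t) • ((0, 0, 1) : Phase) + (q'.1 - q.1, q'.2.1 - q.2.1, 0) := by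
    ext <;> simp
  rw [e, map_add, map_smul, smul_eq_mul, mul_comm]

/-- Trajectories are determined by their initial value. -/
theorem eq_of_hasDerivWithinAt (ha : IsRegularField a a' a'') (hX : IsFlow a T X) (hT : 0 ≤ T)
    {q : Phase} {ξ : ℝ → ℝ} (hc : Continuous ξ) (h0 : ξ 0 = q.2.2)
    (hξ : ∀ t ∈ Icc (-T) T, HasDerivWithinAt ξ (a t (q.1, q.2.1, ξ t)) (Icc (-T) T) t)
    {t : ℝ} (ht : t ∈ Icc (-T) T) : ξ t = X t q := by
  have h := sub_eq_of_hasDerivWithinAt ha (hX.continuous_time hT q) hc (hX.hasDerivWithinAt q)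
    hξ ht
  have e : ((q.1 - q.1, q.2.1 - q.2.1, 0) : Phase) = 0 := by simp
  rw [h0, hX.zero, sub_self, e] at h
  simp only [map_zero, mul_zero, intervalIntegral.integral_zero, add_zero] at h
  exact sub_eq_zero.1 h

theorem exists_lipschitzOnWith (ha : IsRegularField a a' a'') (hX : IsFlow a T X) (hT : 0 ≤ T)
    (N : ℝ) : ∃ C : NNReal, ∀ t, LipschitzOnWith C (X t) (Metric.closedBall 0 N) := by
  obtain ⟨B, hB, hab⟩ := ha.bounded N
  have hcK := (isCompact_Icc (a := -T) (b := T)).prod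
    ((isCompact_closedBall (0 : Phase) (N + B * T)).prod
      (isCompact_closedBall (0 : Phase) (N + B * T)))
  obtain ⟨K₀, hK₀⟩ := hcK.exists_bound_of_continuousOn ha.continuous_meanDeriv.continuousOn
  set K := max K₀ 0 with hK
  have hK0 : 0 ≤ K := le_max_right _ _
  have hBT : 0 ≤ B * T := by positivity
  have hz : ∀ q ∈ Metric.closedBall (0 : Phase) N, ∀ t,
      ((q.1, q.2.1, X t q) : Phase) ∈ Metric.closedBall 0 (N + B * T) := by
    intro q hq t
    rw [mem_closedBall_zero_iff] at hq ⊢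
    have h1 : |q.1| ≤ N := (le_max_left _ _).trans hq
    have h2 : |q.2.1| ≤ N := ((le_max_left _ _).trans (le_max_right _ _)).trans hq
    have h3 : |q.2.2| ≤ N := ((le_max_right _ _).trans (le_max_right _ _)).trans hq
    refine max_le (h1.trans (by linarith)) (max_le (h2.trans (by linarith)) ?_)
    have h4 := hX.abs_sub_le hT hB (fun t x => hab t (q.1, q.2.1, x) h1 h2) t
    have h5 := abs_sub_abs_le_abs_sub (X t q) q.2.2
    show |X t q| ≤ _
    linarith
  -- Variation of constants with every mean derivative bounded by `K` and times by `T`.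
  set C := Real.exp (K * T) * (1 + Real.exp (K * T) * K * T) with hC
  refine ⟨⟨C, by positivity⟩, fun t => LipschitzOnWith.of_dist_le_mul fun q' hq' q hq => ?_⟩
  set t' := max (-T) (min T t)
  have ht' : t' ∈ Icc (-T) T := clamp_mem hT t
  have h0m : (0 : ℝ) ∈ Icc (-T) T := by constructor <;> linarith
  have habs : ∀ s ∈ Icc (-T) T, |s| ≤ T := fun s hs => abs_le.2 hs
  rw [hX.clamp t q, hX.clamp t q', Real.dist_eq, dist_eq_norm]
  have hM : ∀ s ∈ Icc (-T) T, ∀ v, |meanDeriv a' s (q.1, q.2.1, X s q) (q'.1, q'.2.1, X s q') v| ≤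
      K * ‖v‖ := fun s hs v => ContinuousLinearMap.le_of_opNorm_le _
    ((hK₀ (s, (_, _)) ⟨hs, hz q hq s, hz q' hq' s⟩).trans (le_max_left _ _)) v
  have hm : ∀ s ∈ Icc (-T) T, |∫ u in (0 : ℝ)..s,
      meanDeriv a' u (q.1, q.2.1, X u q) (q'.1, q'.2.1, X u q') (0, 0, 1)| ≤ K * T := by
    intro s hs
    have h1 := intervalIntegral.norm_integral_le_of_norm_le_const (a := 0) (b := s) (C := K)
      (f := fun u => meanDeriv a' u (q.1, q.2.1, X u q) (q'.1, q'.2.1, X u q') (0, 0, 1))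
      fun u hu => (hM u (uIcc_subset_Icc h0m hs (uIoc_subset_uIcc hu)) _).trans_eq (by simp)
    refine h1.trans (mul_le_mul_of_nonneg_left ?_ hK0)
    rw [sub_zero]
    exact habs s hs
  have hv : ‖((q'.1 - q.1, q'.2.1 - q.2.1, 0) : Phase)‖ ≤ ‖q' - q‖ := by
    refine max_le (le_max_left _ _) (max_le ((le_max_left _ _).trans (le_max_right _ _)) ?_)
    simp
  have hv3 : |q'.2.2 - q.2.2| ≤ ‖q' - q‖ := (le_max_right _ _).trans (le_max_right _ _)
  have h1 := intervalIntegral.norm_integral_le_of_norm_le_const (a := 0) (b := t')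
    (C := Real.exp (K * T) * (K * ‖q' - q‖))
    (f := fun s => Real.exp (-∫ u in (0 : ℝ)..s,
        meanDeriv a' u (q.1, q.2.1, X u q) (q'.1, q'.2.1, X u q') (0, 0, 1)) *
        meanDeriv a' s (q.1, q.2.1, X s q) (q'.1, q'.2.1, X s q')
          (q'.1 - q.1, q'.2.1 - q.2.1, 0)) fun s hs => by
    have hs' := uIcc_subset_Icc h0m ht' (uIoc_subset_uIcc hs)
    rw [norm_mul, Real.norm_eq_abs, Real.norm_eq_abs, Real.abs_exp]
    refine mul_le_mul (Real.exp_le_exp.2 ((neg_le_abs _).trans (hm s hs')))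
      ((hM s hs' _).trans (mul_le_mul_of_nonneg_left hv hK0)) (abs_nonneg _) (Real.exp_pos _).le
  rw [sub_eq_of_hasDerivWithinAt ha (hX.continuous_time hT q) (hX.continuous_time hT q')
    (hX.hasDerivWithinAt q) (hX.hasDerivWithinAt q') ht', hX.zero, hX.zero, abs_mul, Real.abs_exp]
  have h2 : Real.exp (K * T) * (K * ‖q' - q‖) * |t' - 0| ≤
      Real.exp (K * T) * (K * ‖q' - q‖) * T := by
    rw [sub_zero]
    exact mul_le_mul_of_nonneg_left (habs t' ht') (by positivity)
  calc _ ≤ Real.exp (K * T) * (‖q' - q‖ + Real.exp (K * T) * (K * ‖q' - q‖) * T) := by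
        refine mul_le_mul (Real.exp_le_exp.2 ((le_abs_self _).trans (hm t' ht')))
          ((abs_add_le _ _).trans (add_le_add hv3 (h1.trans h2))) (abs_nonneg _)
          (Real.exp_pos _).le
    _ = C * ‖q' - q‖ := by rw [hC]; ring

/-- Continuity in time for each point, combined with a Lipschitz constant in the point that is
uniform in time. -/
theorem continuous (ha : IsRegularField a a' a'') (hX : IsFlow a T X) (hT : 0 ≤ T) :
    Continuous (uncurry X) := by
  rw [continuous_iff_continuousAt]
  rintro ⟨t, q⟩
  obtain ⟨C, hC⟩ := hX.exists_lipschitzOnWith ha hT (‖q‖ + 1)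
  have h := continuousOn_prod_of_continuousOn_lipschitzOnWith' (uncurry X) (s := univ)
    (t := Metric.closedBall 0 (‖q‖ + 1)) C (fun t _ => hC t)
    (fun q _ => (hX.continuous_time hT q).continuousOn)
  refine h.continuousAt (prod_mem_nhds univ_mem ?_)
  exact Filter.mem_of_superset (Metric.isOpen_ball.mem_nhds (by simp))
    Metric.ball_subset_closedBall

end IsFlow

end

/-! ### Continuous differentiability of the flow and its Jacobian. -/

section

theorem continuous_clm_prod {A E F G : Type*} [TopologicalSpace A] [NormedAddCommGroup E]
    [NormedSpace ℝ E] [NormedAddCommGroup F] [NormedSpace ℝ F] [NormedAddCommGroup G]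
    [NormedSpace ℝ G] {f : A → E →L[ℝ] F} {g : A → E →L[ℝ] G} (hf : Continuous f)
    (hg : Continuous g) : Continuous fun x => (f x).prod (g x) :=
  (ContinuousLinearMap.prodₗᵢ ℝ).continuous.comp (hf.prodMk hg)

namespace IsFlow

variable {a : ℝ → Phase → ℝ} {a' a'' : ℝ → Phase → Phase →L[ℝ] ℝ} {T : ℝ} {X : ℝ → Phase → ℝ}

theorem continuous_meanDeriv (ha : IsRegularField a a' a'') (hX : IsFlow a T X) (hT : 0 ≤ T) :
    Continuous fun z : (Phase × Phase) × ℝ =>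
      meanDeriv a' z.2 (z.1.1.1, z.1.1.2.1, X z.2 z.1.1) (z.1.2.1, z.1.2.2.1, X z.2 z.1.2) := by
  have hXc := hX.continuous ha hT
  have h1 : Continuous fun z : (Phase × Phase) × ℝ => X z.2 z.1.1 :=
    hXc.comp (f := fun z : (Phase × Phase) × ℝ => (z.2, z.1.1)) (by fun_prop)
  have h2 : Continuous fun z : (Phase × Phase) × ℝ => X z.2 z.1.2 :=
    hXc.comp (f := fun z : (Phase × Phase) × ℝ => (z.2, z.1.2)) (by fun_prop)
  exact ha.continuous_meanDeriv.comp (f := fun z : (Phase × Phase) × ℝ =>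
    (z.2, ((z.1.1.1, z.1.1.2.1, X z.2 z.1.1), (z.1.2.1, z.1.2.2.1, X z.2 z.1.2)))) (by fun_prop)

theorem continuous_flowSlope (ha : IsRegularField a a' a'') (hX : IsFlow a T X) (hT : 0 ≤ T) :
    Continuous fun z : (Phase × Phase) × ℝ => flowSlope a' X z.2 z.1.1 z.1.2 := by
  have hM := hX.continuous_meanDeriv ha hT
  have hμ : Continuous fun z : (Phase × Phase) × ℝ => ∫ s in (0 : ℝ)..z.2,
      meanDeriv a' s (z.1.1.1, z.1.1.2.1, X s z.1.1) (z.1.2.1, z.1.2.2.1, X s z.1.2) (0, 0, 1) :=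
    intervalIntegral.continuous_parametric_primitive_of_continuous (μ := volume) (a₀ := 0)
      (f := fun (z : Phase × Phase) s => meanDeriv a' s (z.1.1, z.1.2.1, X s z.1)
        (z.2.1, z.2.2.1, X s z.2) (0, 0, 1)) (hM.clm_apply continuous_const)
  have hI := intervalIntegral.continuous_parametric_primitive_of_continuous (μ := volume) (a₀ := 0)
      (f := fun (z : Phase × Phase) s => Real.exp (-∫ u in (0 : ℝ)..s,
        meanDeriv a' u (z.1.1, z.1.2.1, X u z.1) (z.2.1, z.2.2.1, X u z.2) (0, 0, 1)) •
        (meanDeriv a' s (z.1.1, z.1.2.1, X s z.1) (z.2.1, z.2.2.1, X s z.2)).comp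
          ((ContinuousLinearMap.fst ℝ ℝ (ℝ × ℝ)).prod
            (((ContinuousLinearMap.fst ℝ ℝ ℝ).comp (ContinuousLinearMap.snd ℝ ℝ (ℝ × ℝ))).prod 0)))
      ((Real.continuous_exp.comp hμ.neg).smul (hM.clm_comp continuous_const))
  exact (Real.continuous_exp.comp hμ).smul (continuous_const.add hI)

/-- Once its coefficients are frozen, the variation of constants formula is linear in `q' - q`: the
rating component is the initial gap, the other two give the forcing. -/
theorem sub_eq_flowSlope (ha : IsRegularField a a' a'') (hX : IsFlow a T X) (hT : 0 ≤ T)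
    {t : ℝ} (ht : t ∈ Icc (-T) T) (q q' : Phase) :
    X t q' - X t q = flowSlope a' X t q q' (q' - q) := by
  have hM := hX.continuous_meanDeriv ha hT
  have hM1 : Continuous fun s => meanDeriv a' s (q.1, q.2.1, X s q) (q'.1, q'.2.1, X s q') :=
    hM.comp (f := fun s : ℝ => ((q, q'), s)) (by fun_prop)
  have hμ : Continuous fun s => ∫ u in (0 : ℝ)..s,
      meanDeriv a' u (q.1, q.2.1, X u q) (q'.1, q'.2.1, X u q') (0, 0, 1) :=
    intervalIntegral.continuous_primitive (fun _ _ =>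
      (hM1.clm_apply continuous_const).intervalIntegrable _ _) 0
  rw [sub_eq_of_hasDerivWithinAt ha (hX.continuous_time hT q) (hX.continuous_time hT q')
    (hX.hasDerivWithinAt q) (hX.hasDerivWithinAt q') ht, hX.zero, hX.zero, flowSlope,
    smul_apply, add_apply, ContinuousLinearMap.intervalIntegral_apply
      (Continuous.intervalIntegrable
        ((Real.continuous_exp.comp hμ.neg).smul (hM1.clm_comp continuous_const)) _ _)]
  rfl

/-- The derivative of the flow in the initial point. -/
def deriv (a' : ℝ → Phase → Phase →L[ℝ] ℝ) (T : ℝ) (X : ℝ → Phase → ℝ) (t : ℝ) (q : Phase) :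
    Phase →L[ℝ] ℝ :=
  flowSlope a' X (max (-T) (min T t)) q q

theorem continuous_deriv (ha : IsRegularField a a' a'') (hX : IsFlow a T X) (hT : 0 ≤ T) :
    Continuous fun z : Phase × ℝ => deriv a' T X z.2 z.1 :=
  (hX.continuous_flowSlope ha hT).comp
    (f := fun z : Phase × ℝ => ((z.1, z.1), max (-T) (min T z.2))) (by fun_prop)

theorem hasFDerivAt (ha : IsRegularField a a' a'') (hX : IsFlow a T X) (hT : 0 ≤ T) (t : ℝ)
    (q : Phase) : HasFDerivAt (X t) (deriv a' T X t q) q := by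
  refine hasFDerivAt_of_slope (L := fun q' => flowSlope a' X (max (-T) (min T t)) q q') ?_ ?_
  · exact ((hX.continuous_flowSlope ha hT).comp
      (f := fun q' : Phase => ((q, q'), max (-T) (min T t))) (by fun_prop)).continuousAt
  · intro q'
    rw [hX.clamp t q, hX.clamp t q']
    exact hX.sub_eq_flowSlope ha hT (clamp_mem hT t) q q'

/-- A displacement in the rating alone produces no forcing, so only the exponential factor survives.
-/
theorem deriv_rating (ha : IsRegularField a a' a'') (hX : IsFlow a T X) (hT : 0 ≤ T)
    {t : ℝ} (ht : t ∈ Icc (-T) T) (q : Phase) :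
    deriv a' T X t q (0, 0, 1) =
      Real.exp (∫ s in (0 : ℝ)..t, a' s (q.1, q.2.1, X s q) (0, 0, 1)) := by
  have hM := hX.continuous_meanDeriv ha hT
  have hM1 : Continuous fun s => meanDeriv a' s (q.1, q.2.1, X s q) (q.1, q.2.1, X s q) :=
    hM.comp (f := fun s : ℝ => ((q, q), s)) (by fun_prop)
  have hμ : Continuous fun s => ∫ u in (0 : ℝ)..s,
      meanDeriv a' u (q.1, q.2.1, X u q) (q.1, q.2.1, X u q) (0, 0, 1) :=
    intervalIntegral.continuous_primitive (fun _ _ =>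
      (hM1.clm_apply continuous_const).intervalIntegrable _ _) 0
  rw [deriv, clamp_of_mem ht, flowSlope,
    smul_apply, add_apply, ContinuousLinearMap.intervalIntegral_apply
      (Continuous.intervalIntegrable
        ((Real.continuous_exp.comp hμ.neg).smul (hM1.clm_comp continuous_const)) _ _)]
  have e : ((0, 0, 0) : Phase) = 0 := rfl
  simp [meanDeriv_self, e]

end IsFlow

/-- `Y` is the flow of the field `a` on `[-T, T]`, and `I` is the logarithm of its Jacobian. -/
structure IsSmoothFlow (a : ℝ → Phase → ℝ) (a' : ℝ → Phase → Phase →L[ℝ] ℝ) (T : ℝ)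
    (Y I : ℝ → Phase → ℝ) : Prop where
  contDiff : ContDiff ℝ 1 (uncurry Y)
  contDiff_log : ContDiff ℝ 1 (uncurry I)
  zero : ∀ q, Y 0 q = q.2.2
  log_zero : ∀ q, I 0 q = 0
  hasDerivAt_time : ∀ t ∈ Icc (-T) T, ∀ q,
    HasDerivAt (fun t => Y t q) (a t (q.1, q.2.1, Y t q)) t
  hasDerivAt_log : ∀ t ∈ Icc (-T) T, ∀ q,
    HasDerivAt (fun t => I t q) (a' t (q.1, q.2.1, Y t q) (0, 0, 1)) t
  hasDerivAt_rating : ∀ t ∈ Icc (-T) T, ∀ q : Phase,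
    HasDerivAt (fun r => Y t (q.1, q.2.1, r)) (Real.exp (I t q)) q.2.2
  displacement : ∀ q : Phase, ∃ C, ∀ t ∈ Icc (-T) T, ∀ r, |Y t (q.1, q.2.1, r) - r| ≤ C
  unique : ∀ (q : Phase) (ξ : ℝ → ℝ), Continuous ξ → ξ 0 = q.2.2 → (∀ t ∈ Icc (-T) T,
    HasDerivWithinAt ξ (a t (q.1, q.2.1, ξ t)) (Icc (-T) T) t) → ∀ t ∈ Icc (-T) T, ξ t = Y t q

theorem IsRegularField.exists_flow {a : ℝ → Phase → ℝ} {a' a'' : ℝ → Phase → Phase →L[ℝ] ℝ}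
    (ha : IsRegularField a a' a'') {T : ℝ} (hT : 0 ≤ T) : ∃ Y I, IsSmoothFlow a a' T Y I := by
  obtain ⟨X, hX⟩ := ha.exists_isFlow hT
  have hXc := hX.continuous ha hT
  have hXd := hX.hasFDerivAt ha hT
  have hDc := hX.continuous_deriv ha hT
  have hXc' : Continuous fun z : Phase × ℝ => X z.2 z.1 :=
    hXc.comp (f := fun z : Phase × ℝ => (z.2, z.1)) (by fun_prop)
  have h0m : (0 : ℝ) ∈ Icc (-T) T := by constructor <;> linarith
  set Z' : Phase → ℝ → Phase →L[ℝ] Phase := fun q s =>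
    (ContinuousLinearMap.fst ℝ ℝ (ℝ × ℝ)).prod
      (((ContinuousLinearMap.fst ℝ ℝ ℝ).comp (ContinuousLinearMap.snd ℝ ℝ (ℝ × ℝ))).prod
        (IsFlow.deriv a' T X s q)) with hZ'
  have hZc' : Continuous (uncurry Z') :=
    continuous_clm_prod continuous_const (continuous_clm_prod continuous_const hDc)
  have hZd : ∀ q s, HasFDerivAt (fun q : Phase => ((q.1, q.2.1, X s q) : Phase)) (Z' q s) q :=
    fun q s => hasFDerivAt_fst.prodMk
      ((hasFDerivAt_fst.comp q hasFDerivAt_snd).prodMk (hXd s q))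
  have hz : Continuous fun z : Phase × ℝ => (z.2, ((z.1.1, z.1.2.1, X z.2 z.1) : Phase)) := by
    fun_prop
  have hac : Continuous (uncurry fun (q : Phase) s => a s (q.1, q.2.1, X s q)) :=
    ha.continuous.comp hz
  have hac' : Continuous fun z : Phase × ℝ => a' z.2 (z.1.1, z.1.2.1, X z.2 z.1) :=
    ha.continuous_deriv.comp hz
  have hrc : Continuous (uncurry fun (q : Phase) s => a' s (q.1, q.2.1, X s q) (0, 0, 1)) :=
    hac'.clm_apply continuous_const
  have hrc' : Continuous fun z : Phase × ℝ => a'' z.2 (z.1.1, z.1.2.1, X z.2 z.1) :=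
    ha.continuous_deriv₂.comp hz
  have hY := contDiff_primitive hac
    (F' := fun (q : Phase) s => (a' s (q.1, q.2.1, X s q)).comp (Z' q s))
    (hac'.clm_comp hZc') (fun q s => (ha.hasFDerivAt s _).comp
      (f := fun q : Phase => ((q.1, q.2.1, X s q) : Phase)) q (hZd q s))
  have hI := contDiff_primitive hrc
    (F' := fun (q : Phase) s => (a'' s (q.1, q.2.1, X s q)).comp (Z' q s))
    (hrc'.clm_comp hZc') (fun q s =>
      (ha.hasFDerivAt₂ s _).comp (f := fun q : Phase => ((q.1, q.2.1, X s q) : Phase)) q (hZd q s))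
  -- The stopped flow has only one-sided derivatives at `±T`. Its integral equation defines a
  -- replacement that agrees with it on `[-T, T]` and is jointly `C¹` for all times.
  have hYX : ∀ t ∈ Icc (-T) T, ∀ q : Phase,
      q.2.2 + ∫ s in (0 : ℝ)..t, a s (q.1, q.2.1, X s q) = X t q := by
    intro t ht q
    have h := intervalIntegral.integral_eq_sub_of_hasDeriv_right (a := 0) (b := t)
      (f := fun t => X t q) (f' := fun s => a s (q.1, q.2.1, X s q))
      (hX.continuous_time hT q).continuousOn
      (fun s hs => by
        have h1 : -T ≤ min 0 t := le_min h0m.1 ht.1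
        have h2 : max 0 t ≤ T := max_le h0m.2 ht.2
        exact ((hX.hasDerivWithinAt q s ⟨h1.trans hs.1.le, hs.2.le.trans h2⟩).hasDerivAt
          (Icc_mem_nhds (h1.trans_lt hs.1) (hs.2.trans_le h2))).hasDerivWithinAt)
      ((hac.comp (f := fun s : ℝ => (q, s)) (by fun_prop)).intervalIntegrable _ _)
    rw [h, hX.zero]
    ring
  refine ⟨fun t q => q.2.2 + ∫ s in (0 : ℝ)..t, a s (q.1, q.2.1, X s q),
    fun t q => ∫ s in (0 : ℝ)..t, a' s (q.1, q.2.1, X s q) (0, 0, 1), ?_, ?_, ?_, ?_, ?_, ?_, ?_,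
    ?_, ?_⟩
  · exact ContDiff.add (by fun_prop)
      (hY.comp (f := fun z : ℝ × Phase => (z.2, z.1)) (by fun_prop))
  · exact hI.comp (f := fun z : ℝ × Phase => (z.2, z.1)) (by fun_prop)
  · simp
  · simp
  · intro t ht q
    rw [hYX t ht q]
    exact ((hac.comp (f := fun s : ℝ => (q, s)) (by fun_prop)).integral_hasStrictDerivAt
      0 t).hasDerivAt.const_add q.2.2
  · intro t ht q
    rw [hYX t ht q]
    exact ((hrc.comp (f := fun s : ℝ => (q, s)) (by fun_prop)).integral_hasStrictDerivAt
      0 t).hasDerivAt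
  · intro t ht q
    have h1 := (hXd t q).comp_hasDerivAt (f := fun r => ((q.1, q.2.1, r) : Phase)) q.2.2
      ((hasDerivAt_const _ q.1).prodMk ((hasDerivAt_const _ q.2.1).prodMk (hasDerivAt_id _)))
    rw [hX.deriv_rating ha hT ht] at h1
    exact h1.congr_of_eventuallyEq (.of_forall fun r => hYX t ht _)
  · intro q
    obtain ⟨B, hB, hab⟩ := ha.bounded (max |q.1| |q.2.1|)
    refine ⟨B * T, fun t ht r => ?_⟩
    rw [hYX t ht]
    exact hX.abs_sub_le (q := (q.1, q.2.1, r)) hT hB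
      (fun t x => hab t _ (le_max_left _ _) (le_max_right _ _)) t
  · intro q ξ hc h0 hξ t ht
    rw [hYX t ht]
    exact hX.eq_of_hasDerivWithinAt ha hT hc h0 hξ ht

end

/-! ### The mean-field characteristic system. -/

section

section MeanField

variable {Y : Type*} [TopologicalSpace Y] [CompactSpace Y] [TopologicalSpace.MetrizableSpace Y]
  [SecondCountableTopology Y] [MeasurableSpace Y] [OpensMeasurableSpace Y]
  {μ : Measure Y} [IsFiniteMeasure μ] {m : C(Y, ℝ)} {π : C(Y, Phase)}

/-- The points `π` with their ratings replaced by `Ξ`. -/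
def relocate (π : C(Y, Phase)) (Ξ : C(Y, ℝ)) (y : Y) : Phase := ((π y).1, (π y).2.1, Ξ y)

theorem continuous_relocate {A : Type*} [TopologicalSpace A] {Ξ : A → C(Y, ℝ)} {η : A → Y}
    (hΞ : Continuous Ξ) (hη : Continuous η) : Continuous fun x => relocate π (Ξ x) (η x) := by
  have h1 : Continuous fun x => π (η x) := π.continuous.comp hη
  have h2 : Continuous fun x => Ξ x (η x) := hΞ.eval hη
  unfold relocate
  fun_prop

/-- The average of `k q` over the relocated points with weights `m`. -/
def average (μ : Measure Y) (m : C(Y, ℝ)) (π : C(Y, Phase)) (k : Phase → Phase → ℝ)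
    (Ξ : C(Y, ℝ)) (q : Phase) : ℝ :=
  ∫ y, k q (relocate π Ξ y) * m y ∂μ

/-- The derivative of `average` in the phase point. -/
def averageDeriv (μ : Measure Y) (m : C(Y, ℝ)) (π : C(Y, Phase)) (k : Phase → Phase → ℝ)
    (Ξ : C(Y, ℝ)) (q : Phase) : Phase →L[ℝ] ℝ :=
  ∫ y, m y • (fderiv ℝ (uncurry k) (q, relocate π Ξ y)).comp
    (ContinuousLinearMap.inl ℝ Phase Phase) ∂μ

variable {k : Phase → Phase → ℝ}

theorem continuous_average_integrand (hk : Continuous (uncurry k)) {A : Type*}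
    [TopologicalSpace A] {Ξ : A → C(Y, ℝ)} {q : A → Phase} (hΞ : Continuous Ξ)
    (hq : Continuous q) :
    Continuous (uncurry fun x y => k (q x) (relocate π (Ξ x) y) * m y) := by
  have h1 : Continuous fun z : A × Y => k (q z.1) (relocate π (Ξ z.1) z.2) :=
    hk.comp ((hq.comp continuous_fst).prodMk
      (continuous_relocate (hΞ.comp continuous_fst) continuous_snd))
  exact h1.mul (m.continuous.comp continuous_snd)

theorem continuous_averageDeriv_integrand (hk : ContDiff ℝ 1 (uncurry k)) {A : Type*}
    [TopologicalSpace A] {Ξ : A → C(Y, ℝ)} {q : A → Phase} (hΞ : Continuous Ξ)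
    (hq : Continuous q) :
    Continuous (uncurry fun x y => m y • (fderiv ℝ (uncurry k) (q x, relocate π (Ξ x) y)).comp
      (ContinuousLinearMap.inl ℝ Phase Phase)) := by
  have h1 : Continuous fun z : A × Y =>
      fderiv ℝ (uncurry k) (q z.1, relocate π (Ξ z.1) z.2) :=
    (hk.continuous_fderiv one_ne_zero).comp ((hq.comp continuous_fst).prodMk
      (continuous_relocate (hΞ.comp continuous_fst) continuous_snd))
  exact (m.continuous.comp continuous_snd).smul (h1.clm_comp continuous_const)

theorem continuous_average (hk : Continuous (uncurry k)) {A : Type*}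
    [TopologicalSpace A] [LocallyCompactSpace A] [FirstCountableTopology A] {Ξ : A → C(Y, ℝ)}
    {q : A → Phase} (hΞ : Continuous Ξ) (hq : Continuous q) :
    Continuous fun x => average μ m π k (Ξ x) (q x) := by
  have := continuous_parametric_integral_of_continuous (μ := μ)
    (continuous_average_integrand (m := m) (π := π) hk hΞ hq) isCompact_univ
  simpa only [Measure.restrict_univ] using! this

theorem continuous_averageDeriv (hk : ContDiff ℝ 1 (uncurry k)) {A : Type*}
    [TopologicalSpace A] [LocallyCompactSpace A] [FirstCountableTopology A] {Ξ : A → C(Y, ℝ)}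
    {q : A → Phase} (hΞ : Continuous Ξ) (hq : Continuous q) :
    Continuous fun x => averageDeriv μ m π k (Ξ x) (q x) := by
  have := continuous_parametric_integral_of_continuous (μ := μ)
    (continuous_averageDeriv_integrand (m := m) (π := π) hk hΞ hq) isCompact_univ
  simpa only [Measure.restrict_univ] using! this

theorem hasFDerivAt_average (hk : ContDiff ℝ 1 (uncurry k)) (Ξ : C(Y, ℝ)) (q : Phase) :
    HasFDerivAt (average μ m π k Ξ) (averageDeriv μ m π k Ξ q) q := by
  have := hasFDerivAt_setIntegral_of_isCompact (μ := μ) isOpen_univ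
    (continuous_average_integrand (m := m) (π := π) hk.continuous (continuous_const (y := Ξ))
      continuous_id).continuousOn
    (continuous_averageDeriv_integrand (m := m) (π := π) hk (continuous_const (y := Ξ))
      continuous_id).continuousOn (fun q _ y => ?_) isCompact_univ (mem_univ q)
  · simpa only [Measure.restrict_univ] using! this
  · have h1 : HasFDerivAt (uncurry k) (fderiv ℝ (uncurry k) (q, relocate π Ξ y))
        (q, relocate π Ξ y) := (hk.differentiable one_ne_zero).differentiableAt.hasFDerivAt
    have h2 := (h1.comp (f := fun q => (q, relocate π Ξ y)) q
      (hasFDerivAt_prodMk_left q (relocate π Ξ y))).const_mul (m y)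
    exact h2.congr_of_eventuallyEq (.of_forall fun q => mul_comm _ _)

variable {b w : ℝ → ℝ}

/-- Identifies the rating derivative of the drift as the average of a `C¹` kernel, which makes the
logarithm of the Jacobian `C¹` as well. -/
theorem averageDeriv_kernel (hb : OutcomeFunction b) (hw : RateFunction w) (Ξ : C(Y, ℝ))
    (q : Phase) :
    averageDeriv μ m π (kernel b w) Ξ q (0, 0, 1) = average μ m π (kernelDeriv b w) Ξ q := by
  have hc := continuous_averageDeriv_integrand (m := m) (π := π) (contDiff_kernel hb hw)
    (continuous_const (X := Unit) (y := Ξ)) (continuous_const (y := q))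
  have hi : Integrable (fun y => m y • (fderiv ℝ (uncurry (kernel b w)) (q, relocate π Ξ y)).comp
      (ContinuousLinearMap.inl ℝ Phase Phase)) μ :=
    (hc.comp (f := fun y : Y => ((), y)) (by fun_prop)).integrable_of_hasCompactSupport
      (HasCompactSupport.of_compactSpace _)
  rw [averageDeriv, ContinuousLinearMap.integral_apply hi]
  refine integral_congr_ae (.of_forall fun y => ?_)
  have h1 : HasFDerivAt (uncurry (kernel b w))
      (fderiv ℝ (uncurry (kernel b w)) (q, relocate π Ξ y)) (q, relocate π Ξ y) :=
    ((contDiff_kernel hb hw).differentiable one_ne_zero).differentiableAt.hasFDerivAt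
  have h2 : HasDerivAt (fun ρ : ℝ => (((q.1, q.2.1, ρ), relocate π Ξ y) : Phase × Phase))
      ((0, 0, 1), 0) q.2.2 :=
    ((hasDerivAt_const _ q.1).prodMk ((hasDerivAt_const _ q.2.1).prodMk
      (hasDerivAt_id _))).prodMk (hasDerivAt_const _ _)
  have h3 := (h1.comp_hasDerivAt
    (f := fun ρ : ℝ => (((q.1, q.2.1, ρ), relocate π Ξ y) : Phase × Phase)) q.2.2 h2).unique
    (hasDerivAt_kernel hb hw q.1 q.2.1 q.2.2 (relocate π Ξ y))
  simp only [smul_apply, ContinuousLinearMap.comp_apply, ContinuousLinearMap.inl_apply,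
    smul_eq_mul, h3, mul_comm]

theorem abs_average_le {q : Phase} {Ξ : C(Y, ℝ)} {B : ℝ}
    (hB : ∀ y, |k q (relocate π Ξ y)| ≤ B) :
    |average μ m π k Ξ q| ≤ B * ∫ y, |m y| ∂μ := by
  have hi : Integrable (fun y => |m y|) μ :=
    (by fun_prop : Continuous fun y => |m y|).integrable_of_hasCompactSupport
      (HasCompactSupport.of_compactSpace _)
  rw [← integral_const_mul, ← Real.norm_eq_abs]
  refine norm_integral_le_of_norm_le (hi.const_mul B) (.of_forall fun y => ?_)
  rw [norm_mul]
  exact mul_le_mul_of_nonneg_right (hB y) (abs_nonneg _)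

theorem isRegularField_average (hb : OutcomeFunction b) (hw : RateFunction w)
    {Ξ : ℝ → C(Y, ℝ)} (hΞ : Continuous Ξ) :
    IsRegularField (fun t => average μ m π (kernel b w) (Ξ t))
      (fun t => averageDeriv μ m π (kernel b w) (Ξ t))
      (fun t => averageDeriv μ m π (kernelDeriv b w) (Ξ t)) where
  continuous := continuous_average (A := ℝ × Phase) (contDiff_kernel hb hw).continuous
    (hΞ.comp continuous_fst) continuous_snd
  continuous_deriv := continuous_averageDeriv (A := ℝ × Phase) (contDiff_kernel hb hw)
    (hΞ.comp continuous_fst) continuous_snd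
  continuous_deriv₂ := continuous_averageDeriv (A := ℝ × Phase) (contDiff_kernelDeriv hb hw)
    (hΞ.comp continuous_fst) continuous_snd
  hasFDerivAt t q := hasFDerivAt_average (contDiff_kernel hb hw) (Ξ t) q
  hasFDerivAt₂ t q := by
    simp only [averageDeriv_kernel hb hw]
    exact hasFDerivAt_average (contDiff_kernelDeriv hb hw) (Ξ t) q
  bounded R := by
    obtain ⟨N, hN⟩ := isCompact_univ.exists_bound_of_continuousOn π.continuous.continuousOn
    obtain ⟨B, hB0, hB⟩ := exists_abs_kernel_le_of_norm_le hb hw (max R N)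
    refine ⟨B * ∫ y, |m y| ∂μ, mul_nonneg hB0 (integral_nonneg fun _ => abs_nonneg _),
      fun t q h1 h2 => abs_average_le fun y => ?_⟩
    have h3 := (hN y (mem_univ y)).trans (le_max_right R N)
    exact hB _ _ (h1.trans (le_max_left _ _)) (h2.trans (le_max_left _ _))
      ((le_max_left _ _).trans h3) (((le_max_left _ _).trans (le_max_right _ _)).trans h3)

/-- The vector field of the characteristic system, on the space of rating configurations. -/
def configField (μ : Measure Y) (m : C(Y, ℝ)) (π : C(Y, Phase)) (hb : OutcomeFunction b)
    (hw : RateFunction w) [IsFiniteMeasure μ] (Ξ : C(Y, ℝ)) : C(Y, ℝ) where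
  toFun y := average μ m π (kernel b w) Ξ (relocate π Ξ y)
  continuous_toFun :=
    (continuous_average (contDiff_kernel hb hw).continuous (continuous_const (y := Ξ))
      continuous_id).comp (continuous_relocate continuous_const continuous_id)

/-- The characteristic system has a solution on `[-T, T]`. -/
theorem exists_config (hb : OutcomeFunction b) (hw : RateFunction w) (μ : Measure Y)
    [IsFiniteMeasure μ] (m : C(Y, ℝ)) (π : C(Y, Phase)) {T : ℝ} (hT : 0 ≤ T) :
    ∃ Ξ : ℝ → C(Y, ℝ), Continuous Ξ ∧ (∀ y, Ξ 0 y = (π y).2.2) ∧ ∀ y, ∀ t ∈ Icc (-T) T,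
      HasDerivWithinAt (fun t => Ξ t y)
        (average μ m π (kernel b w) (Ξ t) ((π y).1, (π y).2.1, Ξ t y)) (Icc (-T) T) t := by
  set Ξ₀ : C(Y, ℝ) := ⟨fun y => (π y).2.2, by fun_prop⟩ with hΞ₀
  obtain ⟨N, hN⟩ := isCompact_univ.exists_bound_of_continuousOn π.continuous.continuousOn
  have hN1 : ∀ y, |(π y).1| ≤ N := fun y => (le_max_left _ _).trans (hN y (mem_univ y))
  have hN2 : ∀ y, |(π y).2.1| ≤ N := fun y =>
    ((le_max_left _ _).trans (le_max_right _ _)).trans (hN y (mem_univ y))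
  obtain ⟨B, hB0, hB⟩ := exists_abs_kernel_le_of_norm_le hb hw N
  set M := ∫ y, |m y| ∂μ with hM
  have hM0 : 0 ≤ M := integral_nonneg fun _ => abs_nonneg _
  set L := B * M with hL
  have hL0 : 0 ≤ L := mul_nonneg hB0 hM0
  -- A radius containing all relocated points for configurations in the Picard ball; on pairs of
  -- such points the `C¹` kernel is Lipschitz.
  set S := max N (‖Ξ₀‖ + L * T) with hS
  obtain ⟨κ, hκ⟩ := (contDiff_kernel hb hw).contDiffOn.exists_lipschitzOnWith one_ne_zero
    (convex_closedBall ((0, 0) : Phase × Phase) S) (isCompact_closedBall _ _)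
  have hrel : ∀ Ξ ∈ Metric.closedBall Ξ₀ (L * T), ∀ y, ‖relocate π Ξ y‖ ≤ S := by
    intro Ξ hΞ y
    refine max_le ((hN1 y).trans (le_max_left _ _)) (max_le ((hN2 y).trans (le_max_left _ _)) ?_)
    refine le_trans ?_ (le_max_right _ _)
    have h1 : ‖Ξ - Ξ₀‖ ≤ L * T := mem_closedBall_iff_norm.1 hΞ
    have h2 := norm_le_norm_add_norm_sub' Ξ Ξ₀
    exact (Ξ.norm_coe_le_norm y).trans (by linarith)
  -- The field is bounded by `L` on the whole space of configurations, since the kernel bound does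
  -- not involve ratings; so radius `L * T` is enough for any `T`.
  have hpl : IsPicardLindelof (fun _ : ℝ => configField μ m π hb hw) (tmin := -T) (tmax := T)
      ⟨0, by constructor <;> linarith⟩ Ξ₀ ⟨L * T, by positivity⟩ 0 ⟨L, hL0⟩
      ⟨κ * M, mul_nonneg κ.2 hM0⟩ := by
    refine IsPicardLindelof.of_time_independent (fun Ξ _ => ?_) ?_ ?_
    · refine (ContinuousMap.norm_le _ hL0).2 fun y => ?_
      exact abs_average_le fun y' => hB _ _ (hN1 y) (hN2 y) (hN1 y') (hN2 y')
    · refine LipschitzOnWith.of_dist_le_mul fun Ξ hΞ Ξ' hΞ' => ?_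
      refine (ContinuousMap.dist_le (mul_nonneg (mul_nonneg κ.2 hM0) dist_nonneg)).2 fun y => ?_
      have hint : ∀ Ξ : C(Y, ℝ), Integrable (fun y' => kernel b w (relocate π Ξ y)
          (relocate π Ξ y') * m y') μ := fun Ξ =>
        ((continuous_average_integrand (A := Unit) (contDiff_kernel hb hw).continuous
          (continuous_const (y := Ξ)) (continuous_const (y := relocate π Ξ y))).comp
            (f := fun y' : Y => ((), y')) (by fun_prop)).integrable_of_hasCompactSupport
          (HasCompactSupport.of_compactSpace _)
      have hi : Integrable (fun y => |m y|) μ :=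
        (by fun_prop : Continuous fun y => |m y|).integrable_of_hasCompactSupport
          (HasCompactSupport.of_compactSpace _)
      show |average μ m π (kernel b w) Ξ (relocate π Ξ y) -
        average μ m π (kernel b w) Ξ' (relocate π Ξ' y)| ≤ κ * M * dist Ξ Ξ'
      rw [average, average, ← integral_sub (hint Ξ) (hint Ξ'), mul_right_comm, hM,
        ← integral_const_mul, ← Real.norm_eq_abs]
      refine norm_integral_le_of_norm_le (hi.const_mul _) (.of_forall fun y' => ?_)
      rw [← sub_mul, norm_mul]
      refine mul_le_mul_of_nonneg_right ?_ (abs_nonneg _)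
      have hd : ∀ z, dist (relocate π Ξ z) (relocate π Ξ' z) ≤ dist Ξ Ξ' := fun z => by
        refine max_le ?_ (max_le ?_ (ContinuousMap.dist_apply_le_dist z)) <;>
          simp [relocate]
      have h1 := hκ.dist_le_mul (relocate π Ξ y, relocate π Ξ y')
        (mem_closedBall_zero_iff.2 (max_le (hrel Ξ hΞ y) (hrel Ξ hΞ y')))
        (relocate π Ξ' y, relocate π Ξ' y')
        (mem_closedBall_zero_iff.2 (max_le (hrel Ξ' hΞ' y) (hrel Ξ' hΞ' y')))
      exact h1.trans (mul_le_mul_of_nonneg_left (max_le (hd y) (hd y')) κ.2)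
    · simp only [sub_zero, zero_sub, neg_neg, max_self, NNReal.coe_zero]
      exact le_rfl
  obtain ⟨Ξ, h0, hΞ⟩ := hpl.exists_eq_forall_mem_Icc_hasDerivWithinAt₀
  have h0m : (0 : ℝ) ∈ Icc (-T) T := by constructor <;> linarith
  refine ⟨fun t => Ξ (max (-T) (min T t)), ?_, fun y => ?_, fun y t ht => ?_⟩
  · exact ContinuousOn.comp_continuous (f := fun t : ℝ => max (-T) (min T t))
      (fun t ht => (hΞ t ht).continuousWithinAt) (by fun_prop) fun t => clamp_mem hT t
  · simp only [clamp_of_mem h0m]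
    have h0' : Ξ 0 = Ξ₀ := h0
    rw [h0']
    rfl
  · simp only [clamp_of_mem ht]
    have h1 := (ContinuousMap.evalCLM ℝ y).hasFDerivAt.comp_hasDerivWithinAt t (hΞ t ht)
    exact h1.congr_of_mem (fun s hs => by simp [clamp_of_mem hs]) ht

end MeanField

end

/-! ### The transported density and existence. -/

section

variable {b w : ℝ → ℝ} {f₀ : Phase → ℝ} {T : ℝ} {a : ℝ → Phase → ℝ}
  {a' a'' : ℝ → Phase → Phase →L[ℝ] ℝ} {Y I : ℝ → Phase → ℝ}

/-- There is a flow driven by the drift of the density it transports. -/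
theorem exists_meanField_flow (hb : OutcomeFunction b) (hw : RateFunction w)
    (hf₀ : HasCompactSupport f₀) (hc : Continuous f₀) (hT : 0 ≤ T) :
    ∃ a a' a'' Y I, IsRegularField a a' a'' ∧ IsSmoothFlow a a' T Y I ∧
      ∀ t ∈ Icc (-T) T, ∀ q : Phase,
        a t q = ∫ y : Phase, kernel b w q (y.1, y.2.1, Y t y) * f₀ y := by
  obtain ⟨R, hR, hsupp⟩ := hf₀.exists_pos_le_norm
  let K : Set Phase := Metric.closedBall 0 R
  have hK : IsCompact K := isCompact_closedBall 0 R
  have : CompactSpace K := isCompact_iff_compactSpace.1 hK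
  let μ : Measure K := Measure.comap Subtype.val volume
  have : IsFiniteMeasure μ := ⟨by
    rw [comap_subtype_coe_apply hK.measurableSet, image_univ, Subtype.range_coe]
    exact hK.measure_lt_top⟩
  let m : C(K, ℝ) := ⟨fun y => f₀ y, by fun_prop⟩
  let π : C(K, Phase) := ⟨Subtype.val, continuous_subtype_val⟩
  obtain ⟨Ξ, hΞc, hΞ0, hΞ⟩ := exists_config hb hw μ m π hT
  have ha := isRegularField_average (μ := μ) (m := m) (π := π) hb hw hΞc
  obtain ⟨Y, I, hY⟩ := ha.exists_flow hT
  refine ⟨_, _, _, Y, I, ha, hY, fun t ht q => ?_⟩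
  -- The configuration satisfies the equation of the flow it generates, so uniqueness of
  -- trajectories identifies the two and closes the mean-field loop.
  have h1 : ∀ y : K, relocate π (Ξ t) y = ((y : Phase).1, (y : Phase).2.1, Y t y) := fun y => by
    rw [relocate, hY.unique y (fun t => Ξ t y) (by fun_prop) (hΞ0 y) (hΞ y) t ht]
    rfl
  simp only [average, h1]
  have h2 := integral_subtype_comap (μ := volume) hK.measurableSet
    (fun y : Phase => kernel b w q (y.1, y.2.1, Y t y) * f₀ y)
  refine h2.trans (setIntegral_eq_integral_of_forall_compl_eq_zero fun y hy => ?_)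
  rw [mem_closedBall_zero_iff, not_le] at hy
  rw [hsupp y hy.le, mul_zero]

namespace IsSmoothFlow

theorem strictMono (hY : IsSmoothFlow a a' T Y I) {t : ℝ} (ht : t ∈ Icc (-T) T) (θ σ : ℝ) :
    StrictMono fun r => Y t (θ, σ, r) :=
  strictMono_of_hasDerivAt_pos (fun r => hY.hasDerivAt_rating t ht (θ, σ, r))
    fun _ => Real.exp_pos _

/-- On each line the flow stays at bounded distance from the identity. -/
theorem surjective (hY : IsSmoothFlow a a' T Y I) {t : ℝ} (ht : t ∈ Icc (-T) T) (θ σ : ℝ) :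
    Surjective fun r => Y t (θ, σ, r) := by
  obtain ⟨C, hC⟩ := hY.displacement (θ, σ, 0)
  have hc : Continuous fun r => Y t (θ, σ, r) :=
    hY.contDiff.continuous.comp (f := fun r : ℝ => (t, (θ, σ, r))) (by fun_prop)
  refine hc.surjective ?_ ?_
  · refine tendsto_atTop_mono (f := fun r => r - C) (fun r => ?_)
      (tendsto_atTop_add_const_right _ _ tendsto_id)
    have := (abs_le.1 (hC t ht r)).1
    linarith
  · refine tendsto_atBot_mono (f := fun r => r + C) (fun r => ?_)
      (tendsto_atBot_add_const_right _ _ tendsto_id)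
    have := (abs_le.1 (hC t ht r)).2
    linarith

/-- By Fubini this is the one-dimensional substitution rule on each line of fixed strength and
deviation, where the flow is an increasing bijection with derivative `exp I`. -/
theorem integral_comp (hY : IsSmoothFlow a a' T Y I) {t : ℝ} (ht : t ∈ Icc (-T) T)
    {F : Phase → ℝ} (hF : Integrable F)
    (hF' : Integrable fun y : Phase => F (y.1, y.2.1, Y t y) * Real.exp (I t y)) :
    ∫ q, F q = ∫ y : Phase, F (y.1, y.2.1, Y t y) * Real.exp (I t y) := by
  rw [integral_phase hF, integral_phase hF']
  refine integral_congr_ae (.of_forall fun θ => integral_congr_ae (.of_forall fun σ => ?_))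
  have h := integral_image_eq_integral_abs_deriv_smul MeasurableSet.univ
    (fun r _ => (hY.hasDerivAt_rating t ht (θ, σ, r)).hasDerivWithinAt)
    (hY.strictMono ht θ σ).injective.injOn (fun r => F (θ, σ, r))
  rw [image_univ, (hY.surjective ht θ σ).range_eq, setIntegral_univ, setIntegral_univ] at h
  simpa only [Real.abs_exp, smul_eq_mul, mul_comm] using h

/-- The flow as a map of space-time. -/
def spaceTime (Y : ℝ → Phase → ℝ) (z : ℝ × Phase) : ℝ × Phase :=
  (z.1, (z.2.1, z.2.2.1, Y z.1 z.2))

theorem contDiff_spaceTime (hY : IsSmoothFlow a a' T Y I) : ContDiff ℝ 1 (spaceTime Y) := by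
  have : ContDiff ℝ 1 fun z : ℝ × Phase => Y z.1 z.2 := hY.contDiff
  unfold spaceTime
  fun_prop

/-- The derivative is triangular with diagonal `1, 1, 1, exp I`, hence injective, and bijective by
finite dimension. -/
theorem exists_equiv (hY : IsSmoothFlow a a' T Y I) {t : ℝ} (ht : t ∈ Icc (-T) T) (y : Phase) :
    ∃ e : (ℝ × Phase) ≃L[ℝ] (ℝ × Phase),
      HasFDerivAt (spaceTime Y) (e : (ℝ × Phase) →L[ℝ] (ℝ × Phase)) (t, y) := by
  set D := fderiv ℝ (uncurry Y) (t, y) with hD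
  have hYd : HasFDerivAt (uncurry Y) D (t, y) :=
    (hY.contDiff.differentiable one_ne_zero).differentiableAt.hasFDerivAt
  have h1 : HasDerivAt (fun r : ℝ => ((t, (y.1, y.2.1, r)) : ℝ × Phase)) (0, (0, 0, 1)) y.2.2 :=
    (hasDerivAt_const _ t).prodMk ((hasDerivAt_const _ y.1).prodMk
      ((hasDerivAt_const _ y.2.1).prodMk (hasDerivAt_id _)))
  have h2 : D (0, (0, 0, 1)) = Real.exp (I t y) :=
    (hYd.comp_hasDerivAt (f := fun r : ℝ => ((t, (y.1, y.2.1, r)) : ℝ × Phase)) y.2.2 h1).unique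
      (hY.hasDerivAt_rating t ht y)
  set A : (ℝ × Phase) →L[ℝ] (ℝ × Phase) :=
    (ContinuousLinearMap.fst ℝ ℝ Phase).prod
      (((ContinuousLinearMap.fst ℝ ℝ (ℝ × ℝ)).comp (ContinuousLinearMap.snd ℝ ℝ Phase)).prod
        ((((ContinuousLinearMap.fst ℝ ℝ ℝ).comp (ContinuousLinearMap.snd ℝ ℝ (ℝ × ℝ))).comp
          (ContinuousLinearMap.snd ℝ ℝ Phase)).prod D)) with hA
  have hAd := (ContinuousLinearMap.fst ℝ ℝ Phase).hasFDerivAt.prodMk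
    (((ContinuousLinearMap.fst ℝ ℝ (ℝ × ℝ)).comp
      (ContinuousLinearMap.snd ℝ ℝ Phase)).hasFDerivAt.prodMk
        ((((ContinuousLinearMap.fst ℝ ℝ ℝ).comp (ContinuousLinearMap.snd ℝ ℝ (ℝ × ℝ))).comp
          (ContinuousLinearMap.snd ℝ ℝ Phase)).hasFDerivAt.prodMk hYd))
  have hinj : Injective (A : (ℝ × Phase) →ₗ[ℝ] (ℝ × Phase)) := by
    rw [← LinearMap.ker_eq_bot, LinearMap.ker_eq_bot']
    rintro ⟨s, v₁, v₂, v₃⟩ h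
    have e1 : s = 0 := congrArg Prod.fst h
    have e2 : v₁ = 0 := congrArg (fun z => z.2.1) h
    have e3 : v₂ = 0 := congrArg (fun z => z.2.2.1) h
    have e4 : D (s, (v₁, v₂, v₃)) = 0 := congrArg (fun z => z.2.2.2) h
    subst e1 e2 e3
    have e5 : ((0, (0, 0, v₃)) : ℝ × Phase) = v₃ • (0, (0, 0, 1)) := by simp
    rw [e5, map_smul, h2, smul_eq_mul] at e4
    rw [(mul_eq_zero.1 e4).resolve_right (Real.exp_pos _).ne']
    rfl
  refine ⟨ContinuousLinearEquiv.ofBijective A (LinearMap.ker_eq_bot.2 hinj)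
    (LinearMap.range_eq_top.2 (LinearMap.injective_iff_surjective.1 hinj)), ?_⟩
  rw [ContinuousLinearEquiv.coe_ofBijective]
  exact hAd

end IsSmoothFlow

/-- `f` is the density transported by the flow `Y` on `[-T, T]`. -/
structure IsTransported (f₀ : Phase → ℝ) (T : ℝ) (Y I : ℝ → Phase → ℝ) (f : ℝ → Phase → ℝ) :
    Prop where
  eq : ∀ t ∈ Icc (-T) T, ∀ y : Phase, f t (y.1, y.2.1, Y t y) = f₀ y * Real.exp (-I t y)

/-- On each line surjectivity yields a preimage rating and strict monotonicity its uniqueness.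
Outside `[-T, T]` the preimage is an arbitrary `0`. -/
theorem IsSmoothFlow.exists_isTransported (hY : IsSmoothFlow a a' T Y I) (f₀ : Phase → ℝ) :
    ∃ f, IsTransported f₀ T Y I f := by
  have h : ∀ t (q : Phase), ∃ ρ : ℝ, t ∈ Icc (-T) T → Y t (q.1, q.2.1, ρ) = q.2.2 := by
    intro t q
    by_cases ht : t ∈ Icc (-T) T
    · obtain ⟨ρ, hρ⟩ := hY.surjective ht q.1 q.2.1 q.2.2
      exact ⟨ρ, fun _ => hρ⟩
    · exact ⟨0, fun h => absurd h ht⟩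
  choose ρ hρ using h
  refine ⟨fun t q => f₀ (q.1, q.2.1, ρ t q) * Real.exp (-I t (q.1, q.2.1, ρ t q)),
    ⟨fun t ht y => ?_⟩⟩
  have : ρ t (y.1, y.2.1, Y t y) = y.2.2 :=
    (hY.strictMono ht y.1 y.2.1).injective (hρ t (y.1, y.2.1, Y t y) ht)
  simp only [this]

namespace IsTransported

variable {f : ℝ → Phase → ℝ}

theorem initial (hY : IsSmoothFlow a a' T Y I) (hf : IsTransported f₀ T Y I f) (hT : 0 ≤ T)
    (q : Phase) : f 0 q = f₀ q := by
  have := hf.eq 0 (by constructor <;> linarith) q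
  simpa [hY.zero, hY.log_zero] using this

theorem exists_preimage (hY : IsSmoothFlow a a' T Y I) {t : ℝ} (ht : t ∈ Icc (-T) T) (q : Phase) :
    ∃ y : Phase, (y.1, y.2.1, Y t y) = q := by
  obtain ⟨ρ, hρ⟩ := hY.surjective ht q.1 q.2.1 q.2.2
  exact ⟨(q.1, q.2.1, ρ), by simp only [hρ]⟩

/-- Near each point the density is `f₀ exp(-I)` composed with a local inverse of the space-time
flow. Only the right-inverse property is needed, because the transport identity fixes the value at
any image point. -/
theorem contDiffOn (hY : IsSmoothFlow a a' T Y I) (hf : IsTransported f₀ T Y I f)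
    (hf₀ : ContDiff ℝ 1 f₀) : ContDiffOn ℝ 1 (uncurry f) (Ioo (-T) T ×ˢ univ) := by
  rintro ⟨t, q⟩ ⟨ht, -⟩
  replace ht : t ∈ Ioo (-T) T := ht
  refine ContDiffAt.contDiffWithinAt ?_
  obtain ⟨y, rfl⟩ := exists_preimage hY (Ioo_subset_Icc_self ht) q
  obtain ⟨e, he⟩ := hY.exists_equiv (Ioo_subset_Icc_self ht) y
  have hΨ : ContDiffAt ℝ 1 (IsSmoothFlow.spaceTime Y) (t, y) := hY.contDiff_spaceTime.contDiffAt
  have hs := hΨ.hasStrictFDerivAt' he one_ne_zero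
  have hg := hΨ.to_localInverse he one_ne_zero
  set g := hΨ.localInverse he one_ne_zero with hgdef
  have hinv : ∀ᶠ z in 𝓝 (IsSmoothFlow.spaceTime Y (t, y)), IsSmoothFlow.spaceTime Y (g z) = z :=
    hs.eventually_right_inverse
  have hΦ : ContDiff ℝ 1 fun z : ℝ × Phase => f₀ z.2 * Real.exp (-I z.1 z.2) := by
    have : ContDiff ℝ 1 fun z : ℝ × Phase => I z.1 z.2 := hY.contDiff_log
    fun_prop
  refine (hΦ.contDiffAt.comp _ hg).congr_of_eventuallyEq ?_
  have hopen : ∀ᶠ z : ℝ × Phase in 𝓝 (IsSmoothFlow.spaceTime Y (t, y)), z.1 ∈ Ioo (-T) T :=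
    continuous_fst.continuousAt.eventually (Ioo_mem_nhds ht.1 ht.2)
  filter_upwards [hinv, hopen] with z hz hzt
  have e1 : (g z).1 = z.1 := (Prod.ext_iff.1 hz).1
  have e2 : ((g z).2.1, (g z).2.2.1, Y (g z).1 (g z).2) = z.2 := (Prod.ext_iff.1 hz).2
  rw [e1] at e2
  have := hf.eq z.1 (Ioo_subset_Icc_self hzt) (g z).2
  rw [e2] at this
  simp only [uncurry, Function.comp_apply, this, e1]

theorem exists_support_bound (hY : IsSmoothFlow a a' T Y I) (hf : IsTransported f₀ T Y I f)
    (hf₀ : HasCompactSupport f₀) : ∃ R, ∀ t ∈ Icc (-T) T, ∀ q : Phase, R ≤ ‖q‖ → f t q = 0 := by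
  obtain ⟨R, hR, hsupp⟩ := hf₀.exists_pos_le_norm
  obtain ⟨S, hS⟩ := ((isCompact_Icc (a := -T) (b := T)).prod
    (isCompact_closedBall (0 : Phase) R)).exists_bound_of_continuousOn
      hY.contDiff.continuous.continuousOn
  refine ⟨max R S + 1, fun t ht q hq => ?_⟩
  obtain ⟨y, rfl⟩ := exists_preimage hY ht q
  rw [hf.eq t ht]
  rcases le_or_gt R ‖y‖ with h | h
  · rw [hsupp y h, zero_mul]
  · exfalso
    have h1 : |Y t y| ≤ S := hS (t, y) ⟨ht, by simpa using h.le⟩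
    have h2 : |y.1| ≤ R := (le_max_left _ _).trans h.le
    have h3 : |y.2.1| ≤ R := ((le_max_left _ _).trans (le_max_right _ _)).trans h.le
    have h4 : ‖((y.1, y.2.1, Y t y) : Phase)‖ ≤ max R S :=
      max_le (h2.trans (le_max_left _ _)) (max_le (h3.trans (le_max_left _ _))
        (h1.trans (le_max_right _ _)))
    linarith

theorem continuous_time (hY : IsSmoothFlow a a' T Y I) (hf : IsTransported f₀ T Y I f)
    (hf₀ : ContDiff ℝ 1 f₀) {t : ℝ} (ht : t ∈ Ioo (-T) T) : Continuous (f t) :=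
  (hf.contDiffOn hY hf₀).continuousOn.comp_continuous (f := fun q => (t, q)) (by fun_prop)
    fun _ => ⟨ht, mem_univ _⟩

/-- Change of variables: integrals against the transported density. -/
theorem integral_eq (hY : IsSmoothFlow a a' T Y I) (hf : IsTransported f₀ T Y I f)
    (hs : HasCompactSupport f₀) (hf₀ : ContDiff ℝ 1 f₀) {t : ℝ} (ht : t ∈ Ioo (-T) T)
    {φ : Phase → ℝ} (hφ : Continuous φ) {N : ℝ → ℝ} (hN : Continuous N) (hN0 : N 0 = 0)
    (hNm : ∀ x c, 0 < c → N (x * c) = N x * c) :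
    Integrable (fun q => φ q * N (f t q)) ∧
      ∫ q, φ q * N (f t q) = ∫ y : Phase, φ (y.1, y.2.1, Y t y) * N (f₀ y) := by
  have ht' := Ioo_subset_Icc_self ht
  obtain ⟨R, hR⟩ := hf.exists_support_bound hY hs
  obtain ⟨R₀, -, hsupp⟩ := hs.exists_pos_le_norm
  have hfc := hf.continuous_time hY hf₀ ht
  have hYc : Continuous fun y : Phase => Y t y :=
    hY.contDiff.continuous.comp (f := fun y : Phase => (t, y)) (by fun_prop)
  have hi : Integrable fun q => φ q * N (f t q) :=
    integrable_of_norm_ge (R := R) (by fun_prop) fun y hy => by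
      rw [hR t ht' y hy, hN0, mul_zero]
  -- The Jacobian cancels the factor `exp(-I)` because `N` commutes with positive factors; the cases
  -- used are the identity, for the drift, and the absolute value, for the moments.
  have e : ∀ y : Phase, φ (y.1, y.2.1, Y t y) * N (f t (y.1, y.2.1, Y t y)) * Real.exp (I t y) =
      φ (y.1, y.2.1, Y t y) * N (f₀ y) := fun y => by
    rw [hf.eq t ht', hNm _ _ (Real.exp_pos _), mul_assoc, mul_assoc, ← Real.exp_add]
    simp
  have hf₀c := hf₀.continuous
  refine ⟨hi, ?_⟩
  rw [hY.integral_comp ht' hi]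
  · simp only [e]
  · simp only [e]
    exact integrable_of_norm_ge (R := R₀) (by fun_prop) fun y hy => by
      rw [hsupp y hy, hN0, mul_zero]

theorem isClassicalSolution (hb : OutcomeFunction b) (hw : RateFunction w)
    (hs : HasCompactSupport f₀) (hf₀ : ContDiff ℝ 1 f₀) (hT : 0 < T)
    (ha : IsRegularField a a' a'') (hY : IsSmoothFlow a a' T Y I)
    (hmf : ∀ t ∈ Icc (-T) T, ∀ q : Phase,
      a t q = ∫ y : Phase, kernel b w q (y.1, y.2.1, Y t y) * f₀ y)
    (hf : IsTransported f₀ T Y I f) : IsClassicalSolution b w f₀ T f := by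
  -- The flow was built for negative times too, so that `t = 0` is interior and the one-sided
  -- derivative there is an ordinary one.
  have hsub : Ico 0 T ⊆ Ioo (-T) T := fun t ht => ⟨by linarith [ht.1], ht.2⟩
  have hdrift : ∀ t ∈ Ico 0 T, ∀ θ σ r, drift b w (f t) θ σ r = a t (θ, σ, r) := by
    intro t ht θ σ r
    have hk : Continuous (kernel b w (θ, σ, r)) :=
      (contDiff_kernel hb hw).continuous.comp (f := fun y => ((θ, σ, r), y)) (by fun_prop)
    rw [drift_eq, hmf t (Ioo_subset_Icc_self (hsub ht))]
    exact (hf.integral_eq hY hs hf₀ (hsub ht) hk (N := id) continuous_id rfl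
      (fun _ _ _ => rfl)).2
  have hfd : ∀ t ∈ Ico 0 T, ∀ q, HasFDerivAt (uncurry f) (fderiv ℝ (uncurry f) (t, q)) (t, q) :=
    fun t ht q => (((hf.contDiffOn hY hf₀).contDiffAt (prod_mem_nhds
      (Ioo_mem_nhds (hsub ht).1 (hsub ht).2) univ_mem)).differentiableAt one_ne_zero).hasFDerivAt
  have hflux : ∀ t ∈ Ico 0 T, ∀ θ σ r, HasDerivAt
      (fun ρ => drift b w (f t) θ σ ρ * f t (θ, σ, ρ))
      (a' t (θ, σ, r) (0, 0, 1) * f t (θ, σ, r) +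
        a t (θ, σ, r) * fderiv ℝ (uncurry f) (t, (θ, σ, r)) (0, (0, 0, 1))) r := by
    intro t ht θ σ r
    simp only [hdrift t ht]
    have h1 : HasDerivAt (fun ρ : ℝ => ((θ, σ, ρ) : Phase)) (0, 0, 1) r :=
      (hasDerivAt_const _ θ).prodMk ((hasDerivAt_const _ σ).prodMk (hasDerivAt_id _))
    have h2 := (ha.hasFDerivAt t (θ, σ, r)).comp_hasDerivAt
      (f := fun ρ : ℝ => ((θ, σ, ρ) : Phase)) r h1
    have h3 := (hfd t ht (θ, σ, r)).comp_hasDerivAt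
      (f := fun ρ : ℝ => ((t, (θ, σ, ρ)) : ℝ × Phase)) r ((hasDerivAt_const _ t).prodMk h1)
    exact h2.mul h3
  refine ⟨(hf.contDiffOn hY hf₀).mono (prod_mono_left hsub), fun θ T' hT' => ?_,
    fun t ht θ σ r => (hflux t ht θ σ r).differentiableAt, fun t ht θ σ r => ?_,
    hf.initial hY hT.le⟩
  · have hb2 := hb.contDiff_secondDeriv.continuous
    refine ⟨∫ y : Phase, (1 + |secondDeriv b (θ - y.1)|) * (1 + y.2.1 ^ 2) * |f₀ y|,
      fun s hs' => ?_⟩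
    have h := hf.integral_eq hY hs hf₀ (hsub ⟨hs'.1, hs'.2.trans_lt hT'⟩)
      (φ := fun y : Phase => (1 + |secondDeriv b (θ - y.1)|) * (1 + y.2.1 ^ 2)) (by fun_prop)
      (N := fun x => |x|) continuous_abs abs_zero
      (fun x c hc => by rw [abs_mul, abs_of_pos hc])
    exact ⟨h.1, h.2.le⟩
  · rw [(hflux t ht θ σ r).deriv]
    have hD := hfd t ht (θ, σ, r)
    have htime := hD.comp_hasDerivAt (f := fun s : ℝ => ((s, (θ, σ, r)) : ℝ × Phase)) t
      ((hasDerivAt_id t).prodMk (hasDerivAt_const t (θ, σ, r)))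
    have htw : derivWithin (fun s => f s (θ, σ, r)) (Ico 0 T) t =
        fderiv ℝ (uncurry f) (t, (θ, σ, r)) (1, 0) :=
      htime.hasDerivWithinAt.derivWithin (uniqueDiffOn_Ico 0 T t ht)
    rw [htw]
    have ht' := Ioo_subset_Icc_self (hsub ht)
    obtain ⟨ρ, hρ⟩ := hY.surjective ht' θ σ r
    simp only at hρ
    have hY1 := hY.hasDerivAt_time t ht' (θ, σ, ρ)
    have hI1 := hY.hasDerivAt_log t ht' (θ, σ, ρ)
    simp only [hρ] at hY1 hI1
    have hpath : HasDerivAt (fun s : ℝ => ((s, (θ, σ, Y s (θ, σ, ρ))) : ℝ × Phase))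
        (1, (0, 0, a t (θ, σ, r))) t :=
      (hasDerivAt_id t).prodMk ((hasDerivAt_const _ θ).prodMk
        ((hasDerivAt_const _ σ).prodMk hY1))
    have h1 := HasFDerivAt.comp_hasDerivAt
      (f := fun s : ℝ => ((s, (θ, σ, Y s (θ, σ, ρ))) : ℝ × Phase)) t (by rw [hρ]; exact hD) hpath
    have h2 : HasDerivAt (fun s => f₀ (θ, σ, ρ) * Real.exp (-I s (θ, σ, ρ)))
        (f₀ (θ, σ, ρ) * (Real.exp (-I t (θ, σ, ρ)) * -a' t (θ, σ, r) (0, 0, 1))) t :=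
      hI1.neg.exp.const_mul _
    have hev : (fun s => f₀ (θ, σ, ρ) * Real.exp (-I s (θ, σ, ρ))) =ᶠ[𝓝 t]
        (uncurry f ∘ fun s : ℝ => ((s, (θ, σ, Y s (θ, σ, ρ))) : ℝ × Phase)) := by
      filter_upwards [Ioo_mem_nhds (hsub ht).1 (hsub ht).2] with s hs'
      exact (hf.eq s (Ioo_subset_Icc_self hs') (θ, σ, ρ)).symm
    -- Two computations of the derivative of the density along a characteristic: the chain rule
    -- gives `∂ₜf + a ∂ᵣf`, the explicit formula gives `-(∂ᵣa) f`.
    have h3 := (h1.congr_of_eventuallyEq hev).unique h2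
    have h4 := hf.eq t ht' (θ, σ, ρ)
    simp only [hρ] at h4
    have h5 : ((1, (0, 0, a t (θ, σ, r))) : ℝ × Phase) =
        (1, 0) + a t (θ, σ, r) • (0, (0, 0, 1)) := by
      ext <;> simp
    rw [h5, map_add, map_smul, smul_eq_mul] at h3
    rw [h4]
    linarith

end IsTransported

end

end EloTeams

end

theorem mainTheorem1 (b w : ℝ → ℝ)
    (hb : EloTeams.OutcomeFunction b) (hw : EloTeams.RateFunction w)
    (f₀ : EloTeams.Phase → ℝ)
    (hf₀_supp : HasCompactSupport f₀) (hf₀_C1 : ContDiff ℝ 1 f₀)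
    (T : ℝ) (hT : 0 < T) :
    ∃ f : ℝ → EloTeams.Phase → ℝ,
      EloTeams.IsClassicalSolution b w f₀ T f ∧
      ∀ g : ℝ → EloTeams.Phase → ℝ, EloTeams.IsClassicalSolution b w f₀ T g →
        ∀ t ∈ Set.Ico 0 T, ∀ x : EloTeams.Phase, g t x = f t x := by
  obtain ⟨a, a', a'', Y, I, ha, hY, hmf⟩ :=
    EloTeams.exists_meanField_flow hb hw hf₀_supp hf₀_C1.continuous hT.le
  obtain ⟨f, hf⟩ := hY.exists_isTransported f₀
  have hsol := hf.isClassicalSolution hb hw hf₀_supp hf₀_C1 hT ha hY hmf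
  exact ⟨f, hsol, fun g hg t ht x => hg.unique hb hw hf₀_supp hsol ht.1 ht.2 x⟩
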